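/- Let $p$ be a prime and $P$ a finite $p$-group. Maps are written on the right, and $g^x=x^{-1}gx$. A fusion system $\mathcal F$ on $P$ assigns to each pair $Q,R$ of subgroups of $P$ a set $\mathrm{Hom}_{\mathcal F}(Q,R)$ of injective homomorphisms $Q\to R$, closed under composition, such that: (i) if $g\in P$ and $Q^g\le R$, the conjugation map $Q\to R$, $x\mapsto x^g$, lies in $\mathrm{Hom}_{\mathcal F}(Q,R)$; (ii) if $\phi\in\mathrm{Hom}_{\mathcal F}(Q,R)$, then the induced isomorphism $Q\to Q\phi$ lies in $\mathrm{Hom}_{\mathcal F}(Q,Q\phi)$; (iii) the inverse of an isomorphism in $\mathcal F$ lies in $\mathcal F$. A subgroup $Q$ is fully normalized if $|N_P(Q)|\ge|N_P(R)|$ for every $R$ that is $\mathcal F$-isomorphic to $Q$. The system $\mathcal F$ is saturated if $\mathrm{Aut}_P(P)$ (the group of inner automorphisms of $P$) is a Sylow $p$-subgroup of $\mathrm{Aut}_{\mathcal F}(P)=\mathrm{Hom}_{\mathcal F}(P,P)$, and every $\phi\in\mathrm{Hom}_{\mathcal F}(Q,P)$ with $Q\phi$ fully normalized extends to a member of $\mathrm{Hom}_{\mathcal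 F}(N_\phi,P)$, where $N_\phi$ is the set of $x\in N_P(Q)$ for which there is $y\in N_P(Q\phi)$ with $(g^x)\phi=(g\phi)^y$ for all $g\in Q$. A subgroup $Q\le P$ is strongly $\mathcal F$-closed if every $\mathcal F$-morphism whose domain is contained in $Q$ has image contained in $Q$. Let $\mathcal E$ be a fusion system on a subgroup $Q\le P$ which is a subsystem of $\mathcal F$, that is, $\mathrm{Hom}_{\mathcal E}(R,S)\subseteq\mathrm{Hom}_{\mathcal F}(R,S)$ for all $R,S\le Q$. Then $\mathcal E$ is a normal subsystem of $\mathcal F$, written $\mathcal E\trianglelefteq\mathcal F$, if $Q$ is strongly $\mathcal F$-closed, $\mathcal E$ is saturated, and for all $R\le S\le Q$, $\phi\in\mathrm{Hom}_{\mathcal E}(R,S)$ and $\psi\in\mathrm{Hom}_{\mathcal F}(S,P)$, the map $\psi^{-1}\phi\psi$ lies in $\mathrm{Hom}_{\mathcal E}(R\psi,Q)$. A subgroup $Q\le P$ is normal in $\mathcal F$ if $\mathcal F=N_{\mathcal F}(Q)$, that is, $N_P(Q)=P$ and every $\phi\in\mathrm{Hom}_{\mathcal F}(R,S)$ extends to some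 $\bar\phi\in\mathrm{Hom}_{\mathcal F}(QR,QS)$ with $Q\bar\phi=Q$. There is a largest subgroup of $P$ that is normal in $\mathcal F$; it is denoted by $O_p(\mathcal F)$. Proposition. Let $\mathcal F$ be a saturated fusion system on a finite $p$-group $P$. If $\mathcal E$ is a normal subsystem of $\mathcal F$ on a subgroup $Q$, then $O_p(\mathcal F)\cap Q=O_p(\mathcal E)$. In particular, if $O_p(\mathcal E)\ne1$ for some $\mathcal E\trianglelefteq\mathcal F$, then $O_p(\mathcal F)\ne1$. -/

import Mathlib

/-! Fusion systems on a finite `p`-group. The group `P` carrying a fusion system is a subgroup of an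
ambient group `G` (one may take `G = P`), so that systems on subgroups of `P` are objects of the
same kind. Conjugation is on the right: `g ^ x = x⁻¹ * g * x`. -/

namespace Fusion

variable {G : Type*} [Group G]

/-- The image `Qφ` of a homomorphism `φ : Q → R`, as a subgroup of `G`. -/
def image {Q R : Subgroup G} (φ : Q →* R) : Subgroup G := (R.subtype.comp φ).range

/-- The homomorphism `Q → Qφ` obtained from `φ : Q → R` by restricting the codomain. -/
def toImage {Q R : Subgroup G} (φ : Q →* R) : Q →* image φ := (R.subtype.comp φ).rangeRestrict

/-- The conjugation map `θ_g : Q → R`, `x ↦ g⁻¹ x g`, for `g` with `Q ^ g ≤ R`. -/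
def conjHom (g : G) (Q R : Subgroup G) (h : ∀ x ∈ Q, g⁻¹ * x * g ∈ R) : Q →* R where
  toFun x := ⟨g⁻¹ * x * g, h x x.2⟩
  map_one' := by ext; simp
  map_mul' x y := by ext; simp [mul_assoc]

/-- `φ' : Q' → R'` extends `φ : Q → R`. -/
def Extends {Q R Q' R' : Subgroup G} (φ' : Q' →* R') (φ : Q →* R) : Prop :=
  ∃ h : Q ≤ Q', ∀ x : Q, (φ' (Subgroup.inclusion h x) : G) = φ x

/-- A fusion system on `P`. The objects are the subgroups of `P`; `Hom Q R` is the set of morphisms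
from `Q` to `R` (empty unless `Q` and `R` are contained in `P`). -/
structure FusionSystem (P : Subgroup G) where
  Hom (Q R : Subgroup G) : Set (Q →* R)
  le_of_mem {Q R : Subgroup G} {φ : Q →* R} : φ ∈ Hom Q R → Q ≤ P ∧ R ≤ P
  injective {Q R : Subgroup G} {φ : Q →* R} : φ ∈ Hom Q R → Function.Injective φ
  comp_mem {Q R S : Subgroup G} {φ : Q →* R} {ψ : R →* S} :
    φ ∈ Hom Q R → ψ ∈ Hom R S → ψ.comp φ ∈ Hom Q S
  conj_mem {Q R : Subgroup G} {g : G} : g ∈ P → Q ≤ P → R ≤ P →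
    ∀ h : (∀ x ∈ Q, g⁻¹ * x * g ∈ R), conjHom g Q R h ∈ Hom Q R
  toImage_mem {Q R : Subgroup G} {φ : Q →* R} : φ ∈ Hom Q R → toImage φ ∈ Hom Q (image φ)
  symm_mem {Q R : Subgroup G} {φ : Q ≃* R} :
    φ.toMonoidHom ∈ Hom Q R → φ.symm.toMonoidHom ∈ Hom R Q

namespace FusionSystem

variable {P Q : Subgroup G}

theorem inclusion_mem (F : FusionSystem P) {A B : Subgroup G} (h : A ≤ B) (hB : B ≤ P) :
    Subgroup.inclusion h ∈ F.Hom A B := by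
  have key : Subgroup.inclusion h = conjHom 1 A B (fun x hx => by simpa using h hx) := by
    ext x; simp [conjHom]
  rw [key]
  exact F.conj_mem P.one_mem (h.trans hB) hB _

/-- The group `Aut_F(Q)`. -/
def aut (F : FusionSystem P) (Q : Subgroup G) (hQ : Q ≤ P) : Subgroup (MulAut Q) where
  carrier := {α | α.toMonoidHom ∈ F.Hom Q Q}
  one_mem' := F.inclusion_mem le_rfl hQ
  mul_mem' {_ _} ha hb := F.comp_mem hb ha
  inv_mem' {_} ha := F.symm_mem ha

/-- `Q ≤ P` is fully normalized if `|N_P(R)| ≤ |N_P(Q)|` for all `R` isomorphic to `Q` in `F`. -/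
def FullyNormalized (F : FusionSystem P) (Q : Subgroup G) : Prop :=
  Q ≤ P ∧ ∀ (R : Subgroup G) (φ : Q ≃* R), φ.toMonoidHom ∈ F.Hom Q R →
    Nat.card ↥(P ⊓ Subgroup.normalizer (R : Set G)) ≤
      Nat.card ↥(P ⊓ Subgroup.normalizer (Q : Set G))

/-- The subgroup `N_φ` of `N_P(Q)`: the `x` for which there is `y ∈ N_P(Qφ)` with
`(g ^ x)φ = (gφ) ^ y` for all `g ∈ Q`. -/
def extensionDomain (P : Subgroup G) {Q R : Subgroup G} (φ : Q →* R) : Subgroup G where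
  carrier := {x | x ∈ P ⊓ Subgroup.normalizer (Q : Set G) ∧
    ∃ y ∈ P ⊓ Subgroup.normalizer (image φ : Set G),
      ∀ g g' : Q, (g' : G) = x⁻¹ * g * x → (φ g' : G) = y⁻¹ * φ g * y}
  one_mem' := by
    refine ⟨one_mem _, 1, one_mem _, fun g g' h => ?_⟩
    have : g' = g := Subtype.ext (by simpa using h)
    simp [this]
  mul_mem' := by
    rintro a b ⟨ha, y, hy, h1⟩ ⟨hb, z, hz, h2⟩
    refine ⟨mul_mem ha hb, y * z, mul_mem hy hz, fun g g' h => ?_⟩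
    have hmem : a⁻¹ * (g : G) * a ∈ Q :=
      (Subgroup.mem_normalizer_iff''.1 ha.2 _).1 g.2
    rw [h2 ⟨_, hmem⟩ g' (by rw [h]; simp [mul_assoc]), h1 g ⟨_, hmem⟩ rfl]
    simp [mul_assoc]
  inv_mem' := by
    rintro a ⟨ha, y, hy, h1⟩
    refine ⟨inv_mem ha, y⁻¹, inv_mem hy, fun g g' h => ?_⟩
    rw [h1 g' g (by rw [h]; simp [mul_assoc])]
    simp [mul_assoc]

/-- Saturation (with respect to the prime `p`). Here `Aut_P(P)` is the group of inner automorphisms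
of `P`, the range of `MulAut.conj`. -/
structure IsSaturated (p : ℕ) (F : FusionSystem P) : Prop where
  sylow : ∃ T : Sylow p (F.aut P le_rfl),
    (T : Subgroup (F.aut P le_rfl)).map (F.aut P le_rfl).subtype =
      (MulAut.conj : P →* MulAut P).range
  extend : ∀ (Q : Subgroup G) (φ : Q →* P), φ ∈ F.Hom Q P → F.FullyNormalized (image φ) →
    ∃ φ' ∈ F.Hom (extensionDomain P φ) P, Extends φ' φ

/-- `T ≤ P` is strongly `F`-closed. -/
def StronglyClosed (F : FusionSystem P) (T : Subgroup G) : Prop :=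
  T ≤ P ∧ ∀ (A B : Subgroup G) (φ : A →* B), φ ∈ F.Hom A B → A ≤ T → image φ ≤ T

/-- `E`, on `Q`, is a subsystem of `F`, on `P`. -/
def IsSubsystem (E : FusionSystem Q) (F : FusionSystem P) : Prop :=
  Q ≤ P ∧ ∀ R S : Subgroup G, E.Hom R S ⊆ F.Hom R S

/-- The subsystem `E`, on the strongly `F`-closed subgroup `Q`, is `F`-invariant: for
`R ≤ S ≤ Q`, `φ ∈ Hom_E(R, S)` and `ψ ∈ Hom_F(S, P)`, the map `ψ⁻¹φψ : Rψ → Q` (written from left to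
right; the unique `χ` with `(rψ)χ = (rφ)ψ` for all `r ∈ R`) is a morphism of `E`. -/
structure IsInvariant (E : FusionSystem Q) (F : FusionSystem P) : Prop where
  subsystem : E.IsSubsystem F
  stronglyClosed : F.StronglyClosed Q
  conj : ∀ (R S : Subgroup G) (hRS : R ≤ S), S ≤ Q → ∀ φ ∈ E.Hom R S, ∀ ψ ∈ F.Hom S P,
    ∃ χ ∈ E.Hom (image (ψ.comp (Subgroup.inclusion hRS))) Q,
      ∀ r : R, (χ (toImage (ψ.comp (Subgroup.inclusion hRS)) r) : G) = ψ (φ r)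

/-- `E` is a normal subsystem of `F`. -/
structure IsNormalIn (p : ℕ) (E : FusionSystem Q) (F : FusionSystem P) : Prop where
  invariant : E.IsInvariant F
  saturated : E.IsSaturated p

/-- The morphisms `R → S` of the normalizer `N_F(Q)`, a system on `N_P(Q)`: the `φ ∈ Hom_F(R, S)`
that extend to some `φ' ∈ Hom_F(QR, QS)` restricting to an automorphism of `Q`. (As `R` and `S`
normalize `Q`, the products `QR` and `QS` are the joins.) -/
def normalizerHom (F : FusionSystem P) (Q R S : Subgroup G) : Set (R →* S) :=
  {φ | R ≤ P ⊓ Subgroup.normalizer (Q : Set G) ∧ S ≤ P ⊓ Subgroup.normalizer (Q : Set G) ∧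
    φ ∈ F.Hom R S ∧ ∃ φ' ∈ F.Hom (Q ⊔ R) (Q ⊔ S), Extends φ' φ ∧
      image (φ'.comp (Subgroup.inclusion (le_sup_left : Q ≤ Q ⊔ R))) = Q}

/-- The subgroup `Q` of `P` is normal in `F`: `F = N_F(Q)`, that is, the two systems live on the
same group, `P = N_P(Q)`, and have the same morphisms. -/
structure IsNormalSubgroup (F : FusionSystem P) (Q : Subgroup G) : Prop where
  le : Q ≤ P
  eq_normalizer : P = P ⊓ Subgroup.normalizer (Q : Set G)
  hom_eq : ∀ R S : Subgroup G, F.Hom R S = F.normalizerHom Q R S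

/-- `O_p(F)`, the largest subgroup of `P` that is normal in `F`
(see `isGreatest_Op`). -/
def Op (F : FusionSystem P) : Subgroup G := sSup {Q | F.IsNormalSubgroup Q}

theorem isNormalSubgroup_bot (F : FusionSystem P) : F.IsNormalSubgroup ⊥ := by
  have hN : Subgroup.normalizer ((⊥ : Subgroup G) : Set G) = ⊤ :=
    Subgroup.normalizer_eq_top _
  refine ⟨bot_le, by rw [hN, inf_top_eq], fun R S => Set.ext fun φ => ⟨fun h => ?_, fun h => h.2.2.1⟩⟩
  have hR := (F.le_of_mem h).1
  have hS := (F.le_of_mem h).2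
  have eR : (⊥ : Subgroup G) ⊔ R = R := bot_sup_eq R
  have eS : (⊥ : Subgroup G) ⊔ S = S := bot_sup_eq S
  refine ⟨by rwa [hN, inf_top_eq], by rwa [hN, inf_top_eq], h,
    (Subgroup.inclusion eS.ge).comp (φ.comp (Subgroup.inclusion eR.le)),
    F.comp_mem (F.comp_mem (F.inclusion_mem eR.le hR) h)
      (F.inclusion_mem eS.ge (eS.le.trans hS)), ⟨le_sup_right, fun x => rfl⟩, ?_⟩
  refine (Subgroup.eq_bot_iff_forall _).2 ?_
  rintro _ ⟨x, rfl⟩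
  obtain rfl : x = 1 := Subsingleton.elim _ _
  exact map_one _

theorem IsNormalSubgroup.sup {F : FusionSystem P} {A B : Subgroup G} (hA : F.IsNormalSubgroup A)
    (hB : F.IsNormalSubgroup B) : F.IsNormalSubgroup (A ⊔ B) := by
  have nA : P ≤ Subgroup.normalizer (A : Set G) := inf_eq_left.1 hA.eq_normalizer.symm
  have nB : P ≤ Subgroup.normalizer (B : Set G) := inf_eq_left.1 hB.eq_normalizer.symm
  have nAB : P ≤ Subgroup.normalizer ((A ⊔ B : Subgroup G) : Set G) := by
    have key : ∀ x ∈ P, ∀ h ∈ A ⊔ B, x * h * x⁻¹ ∈ A ⊔ B := by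
      intro x hx h hh
      have : A ⊔ B ≤ (A ⊔ B).comap (MulAut.conj x).toMonoidHom := by
        refine sup_le (fun a ha => ?_) (fun b hb => ?_)
        · exact Subgroup.mem_sup_left ((Subgroup.mem_normalizer_iff.1 (nA hx) a).1 ha)
        · exact Subgroup.mem_sup_right ((Subgroup.mem_normalizer_iff.1 (nB hx) b).1 hb)
      exact this hh
    intro x hx
    refine Subgroup.mem_normalizer_iff.2 fun h => ⟨key x hx h, fun hh => ?_⟩
    have := key x⁻¹ (inv_mem hx) _ hh
    simpa [mul_assoc] using this
  refine ⟨sup_le hA.le hB.le, (inf_eq_left.2 nAB).symm, fun R S =>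
    Set.ext fun φ => ⟨fun h => ?_, fun h => h.2.2.1⟩⟩
  have hR := (F.le_of_mem h).1
  have hS := (F.le_of_mem h).2
  obtain ⟨-, -, -, φ₁, h₁, ⟨i₁, e₁⟩, im₁⟩ := (hA.hom_eq R S).le h
  obtain ⟨-, -, -, φ₂, h₂, ⟨i₂, e₂⟩, im₂⟩ := (hB.hom_eq _ _).le h₁
  have eR : A ⊔ B ⊔ R = B ⊔ (A ⊔ R) := by rw [sup_comm A B, sup_assoc]
  have eS : A ⊔ B ⊔ S = B ⊔ (A ⊔ S) := by rw [sup_comm A B, sup_assoc]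
  refine ⟨le_inf hR (hR.trans nAB), le_inf hS (hS.trans nAB), h,
    (Subgroup.inclusion eS.ge).comp (φ₂.comp (Subgroup.inclusion eR.le)),
    F.comp_mem (F.comp_mem (F.inclusion_mem eR.le (F.le_of_mem h₂).1) h₂)
      (F.inclusion_mem eS.ge (sup_le (sup_le hA.le hB.le) hS)),
    ⟨le_sup_right, fun x => ?_⟩, ?_⟩
  · exact (e₂ (Subgroup.inclusion i₁ x)).trans (e₁ x)
  · let ψ : ↥(B ⊔ (A ⊔ R)) →* G := (B ⊔ (A ⊔ S)).subtype.comp φ₂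
    have mA : (A.subgroupOf (B ⊔ (A ⊔ R))).map ψ = A := by
      refine Eq.trans (le_antisymm ?_ ?_) im₁
      · rintro _ ⟨x, hx, rfl⟩
        exact ⟨⟨x, hx⟩, (e₂ ⟨x, Subgroup.mem_sup_left hx⟩).symm⟩
      · rintro _ ⟨x, rfl⟩
        exact ⟨⟨x, i₂ (Subgroup.mem_sup_left x.2)⟩, x.2, e₂ ⟨x, Subgroup.mem_sup_left x.2⟩⟩
    have mB : (B.subgroupOf (B ⊔ (A ⊔ R))).map ψ = B := by
      refine Eq.trans (le_antisymm ?_ ?_) im₂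
      · rintro _ ⟨x, hx, rfl⟩
        exact ⟨⟨x, hx⟩, rfl⟩
      · rintro _ ⟨x, rfl⟩
        exact ⟨⟨x, Subgroup.mem_sup_left x.2⟩, x.2, rfl⟩
    have mAB : ((A ⊔ B).subgroupOf (B ⊔ (A ⊔ R))).map ψ = A ⊔ B := by
      rw [Subgroup.subgroupOf_sup (le_sup_left.trans le_sup_right) le_sup_left,
        Subgroup.map_sup, mA, mB]
    refine Eq.trans (le_antisymm ?_ ?_) mAB
    · rintro _ ⟨x, rfl⟩
      exact ⟨⟨x, eR.le (Subgroup.mem_sup_left x.2)⟩, x.2, rfl⟩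
    · rintro _ ⟨x, hx, rfl⟩
      exact ⟨⟨x, hx⟩, rfl⟩

theorem isGreatest_Op (F : FusionSystem P) [Finite P] :
    IsGreatest {Q | F.IsNormalSubgroup Q} F.Op := by
  have hfin : {Q | F.IsNormalSubgroup Q}.Finite := by
    refine (Set.finite_range (fun H : Subgroup P => H.map P.subtype)).subset fun Q hQ => ?_
    exact ⟨Q.subgroupOf P, Subgroup.map_subgroupOf_eq_of_le hQ.le⟩
  refine ⟨?_, fun Q hQ => le_sSup hQ⟩
  have key : F.IsNormalSubgroup (hfin.toFinset.sup id) :=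
    Finset.sup_induction F.isNormalSubgroup_bot (fun _ h₁ _ h₂ => h₁.sup h₂)
      (fun Q hQ => hfin.mem_toFinset.1 hQ)
  rw [Finset.sup_id_eq_sSup, hfin.coe_toFinset] at key
  exact key

end FusionSystem

end Fusion

/-! ### Morphisms as functions on the ambient group -/

namespace Fusion

variable {G : Type*} [Group G]

/-! Both inclusions rest on one criterion, `isNormalSubgroup_of_central_series`: in a saturated
system, a subgroup `R` with a central series whose terms are preserved by all morphisms is normal.
Conversely, the lower central series of a normal subgroup is preserved. Being preserved passes
between `E` and `F` far more easily than normality does.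

For the criterion, the elements of `Aut_F(B)` acting trivially on the factors of the series, and on
`P/R`, form a normal `p`-subgroup. If `B` is fully normalized, `Aut_P(B)` is Sylow in `Aut_F(B)`
(`IsSaturated.fullyAutomized`) and so contains it. Hence a morphism from `A` onto such a `B` extends
over `N_R(A)`; normalizers grow, and induction reaches `RA`.

The lower central series of `O_p(F)`, intersected with `Q`, is preserved by `F`, hence by `E`; this
makes `O_p(F) ∩ Q` normal in `E`. The lower central series of `O_p(E)` is preserved by `E`, and by
`Aut_F(Q)`, which permutes the `E`-normal subgroups and so fixes the largest. A Frattini-type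
argument (`IsNormalIn.preserves`) shows that this suffices for `F`: up to `E`-morphisms, morphisms
between proper subgroups of `Q` are quotients of morphisms that extend to larger subgroups of `Q`.
-/

/-- The subgroup generated by `f(A)`; it is `f(A)` itself if `f` is a homomorphism on `A`. -/
def img (A : Subgroup G) (f : G → G) : Subgroup G := Subgroup.closure (f '' A)

theorem mem_img_of_mem {A : Subgroup G} (f : G → G) {x : G} (hx : x ∈ A) : f x ∈ img A f :=
  Subgroup.subset_closure ⟨x, hx, rfl⟩

theorem img_congr {A : Subgroup G} {f g : G → G} (h : ∀ x ∈ A, f x = g x) :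
    img A f = img A g := by
  unfold img
  rw [Set.image_congr h]

/-- A homomorphism between subgroups, extended by `1` to a function. -/
noncomputable def toFun {A B : Subgroup G} (φ : A →* B) : G → G :=
  open Classical in fun x => if h : x ∈ A then φ ⟨x, h⟩ else 1

theorem toFun_coe {A B : Subgroup G} (φ : A →* B) (x : A) :
    toFun φ x = φ x := by
  simp [toFun]

theorem toFun_mk {A B : Subgroup G} (φ : A →* B) {x : G} (hx : x ∈ A) :
    toFun φ x = φ ⟨x, hx⟩ := by
  simp [toFun, hx]

theorem img_le {A B : Subgroup G} {f : G → G} (h : ∀ x ∈ A, f x ∈ B) : img A f ≤ B :=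
  (Subgroup.closure_le _).2 (by rintro _ ⟨x, hx, rfl⟩; exact h x hx)

namespace FusionSystem

variable {P Q : Subgroup G}

/-- The function `f` restricts to a morphism `A → P` of `F`. -/
def Mor (F : FusionSystem P) (A : Subgroup G) (f : G → G) : Prop :=
  ∃ φ ∈ F.Hom A P, ∀ x : A, (φ x : G) = f x

section

variable {F : FusionSystem P} {A B : Subgroup G} {f g : G → G}

theorem mor_toFun {φ : A →* B} (h : φ ∈ F.Hom A B) : F.Mor A (toFun φ) :=
  ⟨(Subgroup.inclusion (F.le_of_mem h).2).comp φ,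
    F.comp_mem h (F.inclusion_mem _ le_rfl), fun x => (toFun_coe φ x).symm⟩

theorem Mor.le (h : F.Mor A f) : A ≤ P := by
  obtain ⟨φ, hφ, -⟩ := h
  exact (F.le_of_mem hφ).1

theorem Mor.map_mem (h : F.Mor A f) {x : G} (hx : x ∈ A) : f x ∈ P := by
  obtain ⟨φ, hφ, e⟩ := h
  exact e ⟨x, hx⟩ ▸ (φ ⟨x, hx⟩).2

theorem Mor.map_mul (h : F.Mor A f) {x y : G} (hx : x ∈ A) (hy : y ∈ A) :
    f (x * y) = f x * f y := by
  obtain ⟨φ, hφ, e⟩ := h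
  rw [← e ⟨x, hx⟩, ← e ⟨y, hy⟩, ← e ⟨x * y, mul_mem hx hy⟩, ← Subgroup.coe_mul, ← _root_.map_mul]
  rfl

theorem Mor.map_one (h : F.Mor A f) : f 1 = 1 := by
  obtain ⟨φ, hφ, e⟩ := h
  exact (e 1).symm.trans (by rw [_root_.map_one, Subgroup.coe_one])

theorem Mor.map_inv (h : F.Mor A f) {x : G} (hx : x ∈ A) : f x⁻¹ = (f x)⁻¹ := by
  rw [eq_inv_iff_mul_eq_one, ← h.map_mul (inv_mem hx) hx, inv_mul_cancel, h.map_one]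

theorem Mor.map_conj (h : F.Mor A f) {x y : G} (hx : x ∈ A) (hy : y ∈ A) :
    f (x⁻¹ * y * x) = (f x)⁻¹ * f y * f x := by
  rw [h.map_mul (mul_mem (inv_mem hx) hy) hx, h.map_mul (inv_mem hx) hy, h.map_inv hx]

theorem Mor.inj (h : F.Mor A f) {x y : G} (hx : x ∈ A) (hy : y ∈ A) (hxy : f x = f y) :
    x = y := by
  obtain ⟨φ, hφ, e⟩ := h
  rw [← e ⟨x, hx⟩, ← e ⟨y, hy⟩] at hxy
  exact congrArg Subtype.val (F.injective hφ (Subtype.ext hxy))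

theorem Mor.congr (h : F.Mor A f) (hfg : ∀ x ∈ A, f x = g x) : F.Mor A g := by
  obtain ⟨φ, hφ, e⟩ := h
  exact ⟨φ, hφ, fun x => (e x).trans (hfg x x.2)⟩

theorem Mor.restrict (h : F.Mor A f) (hBA : B ≤ A) : F.Mor B f := by
  have hA := h.le
  obtain ⟨φ, hφ, e⟩ := h
  exact ⟨φ.comp (Subgroup.inclusion hBA), F.comp_mem (F.inclusion_mem hBA hA) hφ,
    fun x => e (Subgroup.inclusion hBA x)⟩

theorem Mor.mem_img (h : F.Mor A f) {y : G} : y ∈ img A f ↔ ∃ x ∈ A, f x = y := by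
  refine ⟨fun hy => ?_, fun ⟨x, hx, e⟩ => e ▸ mem_img_of_mem f hx⟩
  induction hy using Subgroup.closure_induction with
  | mem y hy => exact hy
  | one => exact ⟨1, one_mem _, h.map_one⟩
  | mul x y _ _ hx hy =>
    obtain ⟨a, ha, rfl⟩ := hx
    obtain ⟨b, hb, rfl⟩ := hy
    exact ⟨a * b, mul_mem ha hb, h.map_mul ha hb⟩
  | inv x _ hx =>
    obtain ⟨a, ha, rfl⟩ := hx
    exact ⟨a⁻¹, inv_mem ha, h.map_inv ha⟩

theorem Mor.img_le_self (h : F.Mor A f) : img A f ≤ P := img_le fun _ hx => h.map_mem hx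

theorem Mor.image_eq_img {φ : A →* B} (e : ∀ x : A, (φ x : G) = f x) (h : F.Mor A f) :
    image φ = img A f := by
  ext y
  rw [h.mem_img]
  refine ⟨?_, ?_⟩
  · rintro ⟨x, rfl⟩
    exact ⟨x, x.2, (e x).symm⟩
  · rintro ⟨x, hx, rfl⟩
    exact ⟨⟨x, hx⟩, e ⟨x, hx⟩⟩

/-- The codomain is immaterial: a morphism can be cut down to its image and then enlarged by an
inclusion. This justifies working with `Mor`, which records only domain and values. -/
theorem Mor.mem_hom (h : F.Mor A f) (hB : B ≤ P) {φ : A →* B} (e : ∀ x : A, (φ x : G) = f x) :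
    φ ∈ F.Hom A B := by
  have him : image φ = img A f := h.image_eq_img e
  obtain ⟨ψ, hψ, e'⟩ := id h
  have him' : image ψ = image φ := by rw [him, h.image_eq_img e']
  have hle : image ψ ≤ B := by
    rw [him', him]
    exact img_le fun x hx => e ⟨x, hx⟩ ▸ (φ ⟨x, hx⟩).2
  have := F.comp_mem (F.toImage_mem hψ) (F.inclusion_mem hle hB)
  convert this using 1
  ext x
  exact (e x).trans (e' x).symm

theorem Mor.exists_hom (h : F.Mor A f) (hB : B ≤ P) (hAB : ∀ x ∈ A, f x ∈ B) :
    ∃ φ ∈ F.Hom A B, ∀ x : A, (φ x : G) = f x := by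
  let φ : A →* B :=
    { toFun := fun x => ⟨f x, hAB x x.2⟩
      map_one' := Subtype.ext h.map_one
      map_mul' := fun x y => Subtype.ext (h.map_mul x.2 y.2) }
  exact ⟨φ, h.mem_hom hB fun x => rfl, fun x => rfl⟩

theorem Mor.comp (hf : F.Mor A f) (hg : F.Mor B g) (hAB : ∀ x ∈ A, f x ∈ B) :
    F.Mor A (g ∘ f) := by
  obtain ⟨φ, hφ, e⟩ := hf.exists_hom hg.le hAB
  obtain ⟨ψ, hψ, e'⟩ := hg
  exact ⟨ψ.comp φ, F.comp_mem hφ hψ, fun x => (e' (φ x)).trans (congrArg g (e x))⟩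

theorem Mor.comp_img (hf : F.Mor A f) (hg : F.Mor (img A f) g) : F.Mor A (g ∘ f) :=
  hf.comp hg fun _ hx => mem_img_of_mem f hx

theorem Mor.img_img (hf : F.Mor A f) (hg : F.Mor (img A f) g) :
    img (img A f) g = img A (g ∘ f) := by
  ext y
  rw [hg.mem_img, (hf.comp_img hg).mem_img]
  constructor
  · rintro ⟨x, hx, rfl⟩
    obtain ⟨z, hz, rfl⟩ := hf.mem_img.1 hx
    exact ⟨z, hz, rfl⟩
  · rintro ⟨x, hx, rfl⟩
    exact ⟨f x, mem_img_of_mem f hx, rfl⟩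

variable (F) in
theorem mor_id (hA : A ≤ P) : F.Mor A id :=
  ⟨Subgroup.inclusion hA, F.inclusion_mem hA le_rfl, fun _ => rfl⟩

variable (F) in
theorem mor_conj (hA : A ≤ P) {y : G} (hy : y ∈ P) : F.Mor A fun x => y⁻¹ * x * y :=
  ⟨_, F.conj_mem hy hA le_rfl fun _ hx => mul_mem (mul_mem (inv_mem hy) (hA hx)) hy,
    fun _ => rfl⟩

/-- A morphism as an isomorphism onto its image. -/
theorem Mor.exists_mulEquiv (h : F.Mor A f) :
    ∃ e : A ≃* img A f, e.toMonoidHom ∈ F.Hom A (img A f) ∧ ∀ x : A, (e x : G) = f x := by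
  obtain ⟨φ, hφ, e⟩ := h.exists_hom h.img_le_self fun x hx => mem_img_of_mem f hx
  refine ⟨MulEquiv.ofBijective φ ⟨F.injective hφ, fun y => ?_⟩, hφ, e⟩
  obtain ⟨x, hx, hxy⟩ := h.mem_img.1 y.2
  exact ⟨⟨x, hx⟩, Subtype.ext ((e ⟨x, hx⟩).trans hxy)⟩

theorem Mor.card_img (h : F.Mor A f) : Nat.card (img A f) = Nat.card A := by
  obtain ⟨e, -⟩ := h.exists_mulEquiv
  exact (Nat.card_congr e.toEquiv).symm

theorem Mor.exists_inv (h : F.Mor A f) :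
    ∃ g, F.Mor (img A f) g ∧ (∀ x ∈ A, g (f x) = x) ∧ (∀ y ∈ img A f, g y ∈ A ∧ f (g y) = y) := by
  obtain ⟨e, he, hef⟩ := h.exists_mulEquiv
  have key : ∀ x ∈ A, toFun e.symm.toMonoidHom (f x) = x := fun x hx => by
    rw [← hef ⟨x, hx⟩, toFun_coe]
    simp
  refine ⟨toFun e.symm.toMonoidHom, mor_toFun (F.symm_mem he), key, fun y hy => ?_⟩
  obtain ⟨x, hx, rfl⟩ := h.mem_img.1 hy
  rw [key x hx]
  exact ⟨hx, rfl⟩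

theorem Mor.img_eq_self [Finite A] (h : F.Mor A f) (hA : ∀ x ∈ A, f x ∈ A) : img A f = A :=
  Subgroup.eq_of_le_of_card_ge (img_le hA) h.card_img.ge

theorem Mor.exists_aut [Finite A] (h : F.Mor A f) (hA : ∀ x ∈ A, f x ∈ A) :
    ∃ α ∈ F.aut A h.le, ∀ x : A, (α x : G) = f x := by
  obtain ⟨φ, hφ, e⟩ := h.exists_hom h.le hA
  exact ⟨MulEquiv.ofBijective φ (Finite.injective_iff_bijective.1 (F.injective hφ)), hφ, e⟩

theorem mor_aut (hA : A ≤ P) {α : MulAut A} (hα : α ∈ F.aut A hA) :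
    F.Mor A (toFun α.toMonoidHom) := mor_toFun hα

theorem toFun_aut (α : MulAut A) (x : A) : toFun α.toMonoidHom x = α x := toFun_coe _ x

theorem Mor.mem_aut (h : F.Mor A f) {α : MulAut A} (e : ∀ x : A, (α x : G) = f x) :
    α ∈ F.aut A h.le :=
  h.mem_hom h.le e

end

theorem _root_.Fusion.mem_normalizer_of_map {F : FusionSystem P} {A : Subgroup G} {f : G → G}
    (h : F.Mor A f) {x y : G} (hx : x ∈ Subgroup.normalizer (A : Set G))
    (hy : ∀ g ∈ A, f (x⁻¹ * g * x) = y⁻¹ * f g * y) :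
    y ∈ Subgroup.normalizer (img A f : Set G) := by
  refine Subgroup.mem_normalizer_iff''.2 fun b => ⟨fun hb => ?_, fun hb => ?_⟩
  · obtain ⟨a, ha, rfl⟩ := h.mem_img.1 hb
    rw [← hy a ha]
    exact mem_img_of_mem f ((Subgroup.mem_normalizer_iff''.1 hx a).1 ha)
  · obtain ⟨a, ha, e⟩ := h.mem_img.1 hb
    have ha' := (Subgroup.mem_normalizer_iff.1 hx a).1 ha
    have := hy _ ha'
    rw [show x⁻¹ * (x * a * x⁻¹) * x = a by group, e, mul_right_cancel_iff,
      mul_left_cancel_iff] at this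
    exact this ▸ mem_img_of_mem f ha'

/-! ### Fully normalized subgroups and the extension axiom -/

theorem fullyNormalized_iff {F : FusionSystem P} {B : Subgroup G} :
    F.FullyNormalized B ↔ B ≤ P ∧ ∀ f, F.Mor B f →
      Nat.card ↥(P ⊓ Subgroup.normalizer (img B f : Set G)) ≤
        Nat.card ↥(P ⊓ Subgroup.normalizer (B : Set G)) := by
  refine and_congr_right fun hB => ⟨fun h f hf => ?_, fun h R φ hφ => ?_⟩
  · obtain ⟨e, he, -⟩ := hf.exists_mulEquiv
    exact h _ e he
  · have hm := mor_toFun hφ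
    have : R = img B (toFun φ.toMonoidHom) := by
      rw [← hm.image_eq_img fun x => (toFun_coe φ.toMonoidHom x).symm]
      ext y
      refine ⟨fun hy => ⟨φ.symm ⟨y, hy⟩, by simp⟩, ?_⟩
      rintro ⟨x, rfl⟩
      exact (φ x).2
    rw [this]
    exact h _ hm

theorem exists_mor_fullyNormalized [Finite P] (F : FusionSystem P) {A : Subgroup G} (hA : A ≤ P) :
    ∃ f, F.Mor A f ∧ F.FullyNormalized (img A f) := by
  let c : Subgroup G → ℕ := fun B => Nat.card ↥(P ⊓ Subgroup.normalizer (B : Set G))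
  let s : Set ℕ := {n | ∃ f, F.Mor A f ∧ c (img A f) = n}
  have hne : s.Nonempty := ⟨_, id, F.mor_id hA, rfl⟩
  have hbdd : BddAbove s := by
    refine ⟨Nat.card P, ?_⟩
    rintro _ ⟨f, hf, rfl⟩
    exact Subgroup.card_le_of_le inf_le_left
  obtain ⟨f, hf, hc⟩ := Nat.sSup_mem hne hbdd
  refine ⟨f, hf, fullyNormalized_iff.2 ⟨hf.img_le_self, fun g hg => ?_⟩⟩
  rw [hf.img_img hg]
  exact (le_csSup hbdd ⟨_, hf.comp_img hg, rfl⟩).trans hc.ge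

/-- The extension axiom: `f` extends to any group `D` of elements `x` of `N_P(A)` for which there is
`y ∈ P` with `(g ^ x)f = (gf) ^ y`. -/
theorem IsSaturated.exists_extension {p : ℕ} {F : FusionSystem P} (hF : F.IsSaturated p)
    {A D : Subgroup G} {f : G → G} (hf : F.Mor A f) (hB : F.FullyNormalized (img A f))
    (hDP : D ≤ P) (hDA : D ≤ Subgroup.normalizer (A : Set G))
    (hD : ∀ x ∈ D, ∃ y ∈ P, ∀ g ∈ A, f (x⁻¹ * g * x) = y⁻¹ * f g * y) :
    ∃ f', F.Mor (A ⊔ D) f' ∧ ∀ x ∈ A, f' x = f x := by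
  obtain ⟨φ, hφ, e⟩ := id hf
  have him : image φ = img A f := hf.image_eq_img e
  obtain ⟨φ', hφ', hle, hext⟩ := hF.extend A φ hφ (him ▸ hB)
  have hD' : D ≤ extensionDomain P φ := by
    intro x hx
    obtain ⟨y, hy, hxy⟩ := hD x hx
    refine ⟨⟨hDP hx, hDA hx⟩, y, ⟨hy, ?_⟩, fun g g' h => ?_⟩
    · rw [him]
      exact mem_normalizer_of_map hf (hDA hx) hxy
    · rw [e, e, h, hxy g g.2]
  refine ⟨toFun φ', (mor_toFun hφ').restrict (sup_le hle hD'), fun x hx => ?_⟩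
  rw [toFun_mk φ' (hle hx), ← e ⟨x, hx⟩, ← hext]
  rfl

end FusionSystem

/-! ### Automizers and Sylow's theorem -/

/-- Normalizers grow in finite `p`-groups. -/
theorem exists_mem_normalizer_notMem {G : Type*} [Group G] {p : ℕ} [Fact p.Prime]
    {A D : Subgroup G} [Finite D] (hD : IsPGroup p D) (hAD : A ≤ D) (hne : A ≠ D) :
    ∃ x ∈ D, x ∉ A ∧ x ∈ Subgroup.normalizer (A : Set G) := by
  have := hD.isNilpotent
  have hlt : A.subgroupOf D < ⊤ := by
    refine lt_top_iff_ne_top.2 fun h => hne (le_antisymm hAD (Subgroup.subgroupOf_eq_top.1 h))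
  obtain ⟨x, hx, hxA⟩ := SetLike.exists_of_lt (Group.normalizerCondition_of_isNilpotent _ hlt)
  refine ⟨x, x.2, fun h => hxA h, Subgroup.mem_normalizer_iff.2 fun a =>
    ⟨fun ha => ?_, fun ha => ?_⟩⟩
  · exact (Subgroup.mem_normalizer_iff.1 hx ⟨a, hAD ha⟩).1 ha
  · have haD : a ∈ D := by
      have := mul_mem (mul_mem (inv_mem x.2) (hAD ha)) x.2
      simpa [mul_assoc] using this
    exact (Subgroup.mem_normalizer_iff.1 hx ⟨a, haD⟩).2 ha

theorem finite_of_le {A B : Subgroup G} [Finite B] (h : A ≤ B) : Finite A :=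
  Finite.of_injective _ (Subgroup.inclusion_injective h)

/-- The group `Aut_P(B)` of automorphisms of `B` induced by conjugation with elements of `P`. -/
def innAut (P B : Subgroup G) : Subgroup (MulAut B) where
  carrier := {α | ∃ y ∈ P, ∀ x : B, (α x : G) = y⁻¹ * x * y}
  one_mem' := ⟨1, one_mem _, fun x => by simp⟩
  mul_mem' := by
    rintro α β ⟨y, hy, h⟩ ⟨z, hz, h'⟩
    refine ⟨z * y, mul_mem hz hy, fun x => ?_⟩
    rw [MulAut.mul_apply, h, h']
    simp [mul_assoc]
  inv_mem' := by
    rintro α ⟨y, hy, h⟩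
    refine ⟨y⁻¹, inv_mem hy, fun x => ?_⟩
    have := h (α⁻¹ x)
    rw [MulAut.apply_inv_self] at this
    rw [this]
    simp [mul_assoc]

/-- Conjugation by an element of the normalizer, as an automorphism. -/
theorem exists_mem_innAut {P B : Subgroup G} {y : G} (hy : y ∈ P)
    (hyB : y ∈ Subgroup.normalizer (B : Set G)) :
    ∃ α ∈ innAut P B, ∀ x : B, (α x : G) = y⁻¹ * x * y := by
  let φ : B →* B := conjHom y B B fun x hx => (Subgroup.mem_normalizer_iff''.1 hyB x).1 hx
  have hφ : Function.Bijective φ := by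
    refine ⟨fun a b h => ?_, fun b => ?_⟩
    · have := congrArg Subtype.val h
      exact Subtype.ext (mul_left_cancel (mul_right_cancel this))
    · refine ⟨⟨y * b * y⁻¹, (Subgroup.mem_normalizer_iff.1 hyB b).1 b.2⟩, Subtype.ext ?_⟩
      change y⁻¹ * (y * b * y⁻¹) * y = b
      group
  exact ⟨MulEquiv.ofBijective φ hφ, ⟨y, hy, fun x => rfl⟩, fun x => rfl⟩

theorem isPGroup_innAut {p : ℕ} {P : Subgroup G} (hP : IsPGroup p P) (B : Subgroup G) :
    IsPGroup p (innAut P B) := by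
  rintro ⟨α, y, hy, h⟩
  obtain ⟨k, hk⟩ := hP ⟨y, hy⟩
  have hk' : y ^ p ^ k = 1 := by simpa using congrArg Subtype.val hk
  have key : ∀ n : ℕ, ∀ x : B, ((α ^ n) x : G) = (y ^ n)⁻¹ * x * y ^ n := by
    intro n
    induction n with
    | zero => simp
    | succ n ih =>
      intro x
      rw [pow_succ', MulAut.mul_apply, h, ih]
      simp [pow_succ, mul_assoc]
  refine ⟨k, Subtype.ext (MulEquiv.ext fun x => Subtype.ext ?_)⟩
  change ((α ^ p ^ k) x : G) = x
  simp [key, hk']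

namespace FusionSystem

variable {P : Subgroup G}

theorem innAut_le_aut (F : FusionSystem P) {B : Subgroup G} (hB : B ≤ P) :
    innAut P B ≤ F.aut B hB := by
  rintro α ⟨y, hy, h⟩
  exact (F.mor_conj hB hy).mem_aut h

/-- `Aut_P(B)` is a Sylow `p`-subgroup of `Aut_F(B)`. -/
def FullyAutomized (p : ℕ) (F : FusionSystem P) (B : Subgroup G) : Prop :=
  ∃ hB : B ≤ P, ∀ T : Subgroup (MulAut B), IsPGroup p T → innAut P B ≤ T → T ≤ F.aut B hB →
    T ≤ innAut P B

/-- The Sylow axiom, in the form of maximality among `p`-subgroups; it is the base case of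
`IsSaturated.fullyAutomized`. -/
theorem IsSaturated.fullyAutomized_self {p : ℕ} {F : FusionSystem P} (hF : F.IsSaturated p) :
    F.FullyAutomized p P := by
  refine ⟨le_rfl, fun T hT hle hTF => ?_⟩
  obtain ⟨S, hS⟩ := hF.sylow
  have heq : innAut P P = (MulAut.conj : P →* MulAut P).range := by
    ext α
    constructor
    · rintro ⟨y, hy, h⟩
      -- The inverse appears because `MulAut.conj` conjugates on the left.
      refine ⟨⟨y, hy⟩⁻¹, MulEquiv.ext fun x => Subtype.ext ?_⟩
      rw [h]
      simp
    · rintro ⟨y, rfl⟩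
      exact ⟨y⁻¹, inv_mem y.2, fun x => by simp⟩
  have hSle : (S : Subgroup (F.aut P le_rfl)) ≤ T.subgroupOf (F.aut P le_rfl) := by
    intro α hα
    exact hle (heq ▸ hS ▸ ⟨α, hα, rfl⟩)
  have hTp : IsPGroup p (T.subgroupOf (F.aut P le_rfl)) :=
    hT.comap_of_injective _ (Subgroup.subtype_injective _)
  have := S.is_maximal' hTp hSle
  rw [heq, ← hS, ← this, Subgroup.map_subgroupOf_eq_of_le hTF]

/-- Sylow's theorem in `Aut_F(B)`: a `p`-group of automorphisms of `A` that is carried into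
`Aut_F(B)` by an isomorphism `e : A → B` is carried into `Aut_P(B)` by some `γ ∘ e`. -/
theorem FullyAutomized.exists_aut {p : ℕ} [Fact p.Prime] (hP : IsPGroup p P) {F : FusionSystem P}
    {A B : Subgroup G} [Finite B] (h : F.FullyAutomized p B) (hB : B ≤ P) (e : A ≃* B)
    {W : Subgroup (MulAut A)} (hW : IsPGroup p W) (hWB : ∀ α ∈ W, MulAut.congr e α ∈ F.aut B hB) :
    ∃ γ ∈ F.aut B hB, ∀ α ∈ W, ∃ x ∈ P, ∀ a : A, (γ (e (α a)) : G) = x⁻¹ * γ (e a) * x := by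
  obtain ⟨_, h⟩ := h
  let H := F.aut B hB
  have hI : IsPGroup p ((innAut P B).subgroupOf H) :=
    (isPGroup_innAut hP B).comap_of_injective _ (Subgroup.subtype_injective _)
  have hmax : ∀ {T : Subgroup H}, IsPGroup p T → (innAut P B).subgroupOf H ≤ T →
      T = (innAut P B).subgroupOf H := by
    intro T hT hle
    refine le_antisymm (fun α hα => ?_) hle
    refine h (T.map H.subtype) (hT.map _) ?_ ?_ ⟨α, hα, rfl⟩
    · intro β hβ
      exact ⟨⟨β, F.innAut_le_aut hB hβ⟩, hle hβ, rfl⟩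
    · rintro _ ⟨β, -, rfl⟩
      exact β.2
  let S₀ : Sylow p H := ⟨_, hI, hmax⟩
  let W' : Subgroup H := (W.map (MulAut.congr e).toMonoidHom).subgroupOf H
  have hW' : IsPGroup p W' :=
    (hW.map _).comap_of_injective _ (Subgroup.subtype_injective _)
  obtain ⟨S, hS⟩ := hW'.exists_le_sylow
  obtain ⟨γ, hγ⟩ := MulAction.exists_smul_eq H S S₀
  refine ⟨γ, γ.2, fun α hα => ?_⟩
  have h1 : (⟨_, hWB α hα⟩ : H) ∈ S := hS ⟨α, hα, rfl⟩
  have h2 : γ * ⟨_, hWB α hα⟩ * γ⁻¹ ∈ S₀ := by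
    rw [← hγ]
    exact Subgroup.smul_mem_pointwise_smul _ (MulAut.conj γ) (S : Subgroup H) h1
  obtain ⟨x, hx, hxe⟩ : γ.1 * MulAut.congr e α * γ.1⁻¹ ∈ innAut P B := h2
  refine ⟨x, hx, fun a => ?_⟩
  rw [← hxe]
  simp [MulAut.congr]

/-- Some power of `β` generates a `p`-group, while the same power of the permutation `τ` of
`p`-power order is `τ`. -/
theorem exists_isPGroup_zpowers {p : ℕ} [Fact p.Prime] {M : Type*} [Group M] [Finite M]
    (β : M) {X : Type*} (τ : Equiv.Perm X) (hτ : ∃ k, τ ^ p ^ k = 1) :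
    ∃ e : ℕ, IsPGroup p (Subgroup.zpowers (β ^ e)) ∧ τ ^ e = τ := by
  obtain ⟨k, hk⟩ := hτ
  obtain ⟨a, m, hm, ho⟩ :=
    Nat.exists_eq_pow_mul_and_not_dvd (orderOf_pos β).ne' p (Fact.out : p.Prime).ne_one
  have hco : (p ^ k).Coprime m :=
    Nat.Coprime.pow_left k ((Nat.Prime.coprime_iff_not_dvd Fact.out).2 hm)
  -- `e ≡ 1` modulo `p ^ k` fixes `τ`, and `e ≡ 0` modulo the `p'`-part `m` of the order of `β`
  -- kills its `p'`-part.
  obtain ⟨e, he1, he2⟩ := Nat.chineseRemainder hco 1 0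
  refine ⟨e, ?_, ?_⟩
  · have h1 : (β ^ e) ^ p ^ a = 1 := by
      obtain ⟨c, rfl⟩ := (Nat.modEq_zero_iff_dvd.1 he2)
      rw [← pow_mul, ← orderOf_dvd_iff_pow_eq_one, ho]
      exact ⟨c, by ring⟩
    rintro ⟨_, n, rfl⟩
    refine ⟨a, Subtype.ext ?_⟩
    change ((β ^ e) ^ n) ^ p ^ a = 1
    rw [← zpow_natCast, zpow_comm, zpow_natCast, h1, one_zpow]
  · have := pow_eq_pow_iff_modEq.2 (he1.of_dvd (orderOf_dvd_of_pow_eq_one hk))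
    rw [this, pow_one]

/-- Fully normalized subgroups are fully automized. -/
theorem IsSaturated.fullyAutomized {p : ℕ} [Fact p.Prime] [Finite P] (hP : IsPGroup p P)
    {F : FusionSystem P} (hF : F.IsSaturated p) {B : Subgroup G} (hB : F.FullyNormalized B) :
    F.FullyAutomized p B := by
  induction hn : Nat.card P - Nat.card B using Nat.strong_induction_on generalizing B with
  | _ n ih =>
  subst hn
  have hBP := hB.1
  by_cases hne : B = P
  · subst hne
    exact hF.fullyAutomized_self
  have := finite_of_le hBP
  refine ⟨hBP, fun T hT hle hTF => ?_⟩
  by_contra hcon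
  -- If `Aut_P(B)` is not Sylow, some `t` of `p`-power order normalizes it without lying in it. The
  -- aim is to show that `t` is nevertheless conjugation by an element of `P`.
  obtain ⟨t, htT, htI, htN⟩ := exists_mem_normalizer_notMem hT hle
    (fun h => hcon h.ge)
  have ht : F.Mor B (toFun t.toMonoidHom) := mor_aut hBP (hTF htT)
  have htB : ∀ b : B, toFun t.toMonoidHom b = t b := toFun_aut t
  have htB' : ∀ b ∈ B, toFun t.toMonoidHom b ∈ B := fun b hb => htB ⟨b, hb⟩ ▸ (t _).2
  have himt : img B (toFun t.toMonoidHom) = B := ht.img_eq_self htB'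
  let N := P ⊓ Subgroup.normalizer (B : Set G)
  have hBN : B ≤ N := le_inf hBP Subgroup.le_normalizer
  have hNP : N ≤ P := inf_le_left
  have := finite_of_le hNP
  -- As `t` normalizes `Aut_P(B)`, its extension domain is all of `N = N_P(B)`.
  obtain ⟨f, hf, hfB⟩ := hF.exists_extension (D := N) ht (himt.symm ▸ hB) hNP inf_le_right (by
    rintro x ⟨hx, hxB⟩
    obtain ⟨α, hα, hαx⟩ := exists_mem_innAut hx hxB
    obtain ⟨y, hy, hyα⟩ := (Subgroup.mem_normalizer_iff.1 htN α).1 hα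
    refine ⟨y, hy, fun g hg => ?_⟩
    rw [htB ⟨g, hg⟩, ← hyα, ← hαx ⟨g, hg⟩, htB]
    simp)
  replace hf := hf.restrict (le_sup_right : N ≤ B ⊔ N)
  have hfN : ∀ x ∈ N, f x ∈ N := by
    intro x hx
    refine ⟨hf.map_mem hx, ?_⟩
    have := mem_normalizer_of_map (hf.restrict hBN) (y := f x) hx.2
      fun g hg => hf.map_conj hx (hBN hg)
    rwa [img_congr hfB, himt] at this
  obtain ⟨β, hβ, hβf⟩ := hf.exists_aut hfN
  have hpow : ∀ (n : ℕ) (b : B), ((β ^ n) ⟨b, hBN b.2⟩ : G) = (t ^ n) b := by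
    intro n
    induction n with
    | zero => simp
    | succ n ih =>
      intro b
      rw [pow_succ, pow_succ, MulAut.mul_apply, MulAut.mul_apply, ← ih]
      congr 2
      exact Subtype.ext ((hβf _).trans ((hfB b b.2).trans (htB b)))
  obtain ⟨k, hk⟩ := hT ⟨t, htT⟩
  have hk' : t ^ p ^ k = 1 := by simpa using congrArg Subtype.val hk
  -- Replaces the extension `β` by a power of `p`-power order that still restricts to `t`.
  obtain ⟨e, he, het⟩ := exists_isPGroup_zpowers (p := p) β (MulAut.toPerm B t)
    ⟨k, by rw [← map_pow, hk', map_one]⟩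
  have het' : t ^ e = t := by
    rw [← map_pow] at het
    exact MulEquiv.ext fun x => DFunLike.congr_fun het x
  have hβe : ∀ b : B, ((β ^ e) ⟨b, hBN b.2⟩ : G) = t b := fun b => by rw [hpow, het']
  obtain ⟨ψ, hψ, hψN⟩ := F.exists_mor_fullyNormalized hNP
  obtain ⟨ε, hε, hεψ⟩ := hψ.exists_mulEquiv
  have hN'P := hψN.1
  have := finite_of_le hN'P
  have hBltN : Nat.card B < Nat.card N := by
    obtain ⟨x, hxP, hxB, hxN⟩ := exists_mem_normalizer_notMem hP hBP hne
    by_contra! hcard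
    exact hxB (Subgroup.eq_of_le_of_card_ge hBN hcard ▸ ⟨hxP, hxN⟩)
  have hNcard : Nat.card N ≤ Nat.card P := Subgroup.card_le_of_le hNP
  -- `N` is larger than `B`, so induction applies to its fully normalized conjugate, and Sylow's
  -- theorem there makes `β ^ e` conjugation by some `x ∈ P`.
  have hFA := ih _ (by rw [hψ.card_img]; omega) hψN rfl
  obtain ⟨γ, hγ, hγx⟩ := hFA.exists_aut hP hN'P ε he (by
    intro α hα
    have hα' : α ∈ F.aut N hNP :=
      (Subgroup.zpowers_le.2 (pow_mem hβ e)) hα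
    exact F.comp_mem (F.comp_mem (F.symm_mem hε) hα') hε)
  obtain ⟨x, hxP, hx⟩ := hγx _ (Subgroup.mem_zpowers _)
  let χ : N →* img N ψ := γ.toMonoidHom.comp ε.toMonoidHom
  have hχ : F.Mor N (toFun χ) := mor_toFun (F.comp_mem hε hγ)
  have hχγ : ∀ n : N, toFun χ n = γ (ε n) := toFun_coe χ
  have hχB := hχ.restrict hBN
  have hxC : x ∈ Subgroup.normalizer (img B (toFun χ) : Set G) := by
    refine Subgroup.mem_normalizer_iff''.2 fun b => ?_
    rw [hχB.mem_img, hχB.mem_img]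
    constructor
    · rintro ⟨a, ha, rfl⟩
      refine ⟨t ⟨a, ha⟩, (t _).2, ?_⟩
      rw [← hβe, hχγ, hx, ← hχγ]
    · rintro ⟨a, ha, hab⟩
      obtain ⟨a', ha'⟩ := t.surjective ⟨a, ha⟩
      refine ⟨a', a'.2, ?_⟩
      have := hχγ ((β ^ e) ⟨a', hBN a'.2⟩)
      rw [hβe, ha', hab, hx, ← hχγ] at this
      exact (mul_left_cancel (mul_right_cancel this)).symm
  have himχ : img N (toFun χ) ≤ P ⊓ Subgroup.normalizer (img B (toFun χ) : Set G) := by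
    refine img_le fun y hy => ⟨hχ.map_mem hy, ?_⟩
    exact mem_normalizer_of_map hχB hy.2 fun g hg => hχ.map_conj hy (hBN hg)
  have hle' : Nat.card ↥(P ⊓ Subgroup.normalizer (img B (toFun χ) : Set G)) ≤ Nat.card N :=
    (fullyNormalized_iff.1 hB).2 _ hχB
  have := finite_of_le (inf_le_left : P ⊓ Subgroup.normalizer (img B (toFun χ) : Set G) ≤ P)
  -- Full normalization of `B` forces `Nχ = N_P(Bχ)`. This contains `x`, so `x = zχ` with `z ∈ N`,
  -- and `z` induces `t` on `B`.
  have heq := Subgroup.eq_of_le_of_card_ge himχ (by rw [hχ.card_img]; exact hle')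
  obtain ⟨z, hz, hzx⟩ := hχ.mem_img.1 (heq.ge ⟨hxP, hxC⟩)
  refine htI ⟨z, hz.1, fun b => hχ.inj (hBN (t b).2) ?_ ?_⟩
  · exact mul_mem (mul_mem (inv_mem hz) (hBN b.2)) hz
  · rw [hχ.map_conj hz (hBN b.2), hzx, ← hβe, hχγ, hx, ← hχγ]

end FusionSystem

/-! ### Preserved subgroups and the central series criterion -/

namespace FusionSystem

variable {P : Subgroup G}

/-- Every morphism of `F` maps elements of `X` to elements of `X`. -/
def Preserves (F : FusionSystem P) (X : Subgroup G) : Prop :=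
  ∀ ⦃A : Subgroup G⦄ ⦃f : G → G⦄, F.Mor A f → ∀ x ∈ A, x ∈ X → f x ∈ X

theorem StronglyClosed.preserves {F : FusionSystem P} {X : Subgroup G} (h : F.StronglyClosed X) :
    F.Preserves X := by
  intro A f hf x hxA hxX
  have hm := hf.restrict (inf_le_left : A ⊓ X ≤ A)
  obtain ⟨φ, hφ, e⟩ := id hm
  have hle := h.2 _ _ φ hφ inf_le_right
  rw [hm.image_eq_img e] at hle
  exact hle (mem_img_of_mem f ⟨hxA, hxX⟩)

/-- The inverse of a morphism is again a morphism. -/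
theorem Preserves.mem_iff {F : FusionSystem P} {X : Subgroup G} (h : F.Preserves X)
    {A : Subgroup G} {f : G → G} (hf : F.Mor A f) {x : G} (hx : x ∈ A) : f x ∈ X ↔ x ∈ X := by
  refine ⟨fun hfx => ?_, h hf x hx⟩
  obtain ⟨g, hg, hgf, -⟩ := hf.exists_inv
  rw [← hgf x hx]
  exact h hg _ (mem_img_of_mem f hx) hfx

theorem Preserves.inf {F : FusionSystem P} {X Y : Subgroup G} (hX : F.Preserves X)
    (hY : F.Preserves Y) : F.Preserves (X ⊓ Y) :=
  fun _ _ hf x hx hxXY => ⟨hX hf x hx hxXY.1, hY hf x hx hxXY.2⟩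

theorem Preserves.conj_mem {F : FusionSystem P} {X : Subgroup G} (h : F.Preserves X)
    (hX : X ≤ P) {x y : G} (hx : x ∈ X) (hy : y ∈ P) : y⁻¹ * x * y ∈ X :=
  h (F.mor_conj hX hy) x hx hx

theorem Preserves.le_normalizer {F : FusionSystem P} {X : Subgroup G} (h : F.Preserves X)
    (hX : X ≤ P) : P ≤ Subgroup.normalizer (X : Set G) := by
  intro y hy
  refine Subgroup.mem_normalizer_iff''.2 fun x => ⟨fun hx => h.conj_mem hX hx hy, fun hx => ?_⟩
  have := h.conj_mem hX hx (inv_mem hy)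
  simpa [mul_assoc] using this

/-- The automorphisms in `Aut_F(B)` that act trivially on the factors of a chain. -/
def chainStabilizer (F : FusionSystem P) {B : Subgroup G} (hB : B ≤ P) {M : ℕ → Subgroup G}
    (hM : ∀ i, F.Preserves (M i)) : Subgroup (F.aut B hB) where
  carrier := {α | ∀ i, ∀ x : B, (x : G) ∈ M i → (α.1 x : G) * (x : G)⁻¹ ∈ M (i + 1)}
  one_mem' := fun i x _ => by
    change (x : G) * (x : G)⁻¹ ∈ _
    rw [mul_inv_cancel]
    exact one_mem _
  mul_mem' := by
    intro α β hα hβ i x hx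
    have hx' : (β.1 x : G) ∈ M i := by
      rw [← toFun_aut]
      exact hM i (mor_aut hB β.2) x x.2 hx
    have := mul_mem (hα i (β.1 x) hx') (hβ i x hx)
    rw [← mul_assoc, inv_mul_cancel_right] at this
    exact this
  inv_mem' := by
    intro α hα i x hx
    have hx' : ((α⁻¹).1 x : G) ∈ M i := by
      rw [← toFun_aut]
      exact hM i (mor_aut hB (α⁻¹).2) x x.2 hx
    have h := inv_mem (hα i _ hx')
    have e : α.1 ((α⁻¹).1 x) = x := MulAut.apply_inv_self _ α.1 x
    rw [e, mul_inv_rev, inv_inv] at h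
    exact h

instance chainStabilizer_normal (F : FusionSystem P) {B : Subgroup G} (hB : B ≤ P)
    {M : ℕ → Subgroup G} (hM : ∀ i, F.Preserves (M i)) : (F.chainStabilizer hB hM).Normal := by
  refine ⟨fun α hα γ i x hx => ?_⟩
  have hy : ((γ⁻¹).1 x : G) ∈ M i := by
    rw [← toFun_aut]
    exact hM i (mor_aut hB (γ⁻¹).2) x x.2 hx
  have e : γ.1 ((γ⁻¹).1 x) = x := MulAut.apply_inv_self _ γ.1 x
  have h := hα i _ hy
  have h' := hM _ (mor_aut hB γ.2) _ (mul_mem (α.1 ((γ⁻¹).1 x)).2 (inv_mem ((γ⁻¹).1 x).2)) h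
  rw [← Subgroup.coe_inv, ← Subgroup.coe_mul, toFun_aut, map_mul, map_inv, e] at h'
  exact h'

/-- Climbing the chain from the bottom, each factor costs a power `p ^ q = |P|`. If `β` fixes `B ∩ M
(i + 1)` pointwise and `x ∈ B ∩ M i`, then `β x = z x` with `z` fixed by `β`. Hence `β ^ m` sends
`x` to `z ^ m x`, which is `x` for `m = p ^ q`. -/
theorem isPGroup_chainStabilizer {p : ℕ} [Fact p.Prime] [Finite P] (hP : IsPGroup p P)
    (F : FusionSystem P) {B : Subgroup G} (hB : B ≤ P) {M : ℕ → Subgroup G}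
    (hM : ∀ i, F.Preserves (M i)) (h0 : M 0 = P) {n : ℕ} (hn : M n = ⊥) :
    IsPGroup p (F.chainStabilizer hB hM) := by
  obtain ⟨q, hq⟩ := IsPGroup.iff_card.1 hP
  have hpow : ∀ x ∈ P, x ^ p ^ q = 1 := fun x hx => by
    have := pow_card_eq_one' (G := P) (x := ⟨x, hx⟩)
    rw [hq] at this
    simpa using congrArg Subtype.val this
  have key : ∀ j ≤ n, ∀ α ∈ F.chainStabilizer hB hM, ∀ x : B, (x : G) ∈ M (n - j) →
      (α ^ p ^ (q * j)).1 x = x := by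
    intro j
    induction j with
    | zero =>
      intro _ α _ x hx
      rw [Nat.sub_zero, hn, Subgroup.mem_bot] at hx
      rw [show x = 1 from Subtype.ext hx, map_one]
    | succ j ih =>
      intro hj α hα x hx
      let β := α ^ p ^ (q * j)
      have hβ : β ∈ F.chainStabilizer hB hM := pow_mem hα _
      let z : B := β.1 x * x⁻¹
      have hz : (z : G) ∈ M (n - j) := by
        have := hβ _ x hx
        rwa [show n - (j + 1) + 1 = n - j by omega] at this
      have hβz : β.1 z = z := ih (by omega) α hα z hz
      have hβn : ∀ m : ℕ, (β ^ m).1 x = z ^ m * x := by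
        intro m
        induction m with
        | zero => simp
        | succ m ihm =>
          have e : (β ^ (m + 1)).1 x = β.1 ((β ^ m).1 x) := by rw [pow_succ']; rfl
          have e' : β.1 x = z * x := by simp [z]
          rw [e, ihm, map_mul, map_pow, hβz, e', pow_succ]
          exact (mul_assoc _ _ _).symm
      have hzq : z ^ p ^ q = 1 := Subtype.ext (by simpa using hpow z (hB z.2))
      have := hβn (p ^ q)
      rw [hzq, one_mul, ← pow_mul, ← pow_add] at this
      rwa [Nat.mul_succ]
  rintro ⟨α, hα⟩
  refine ⟨q * n, Subtype.ext (Subtype.ext (MulEquiv.ext fun x => ?_))⟩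
  exact key n le_rfl α hα x (by rw [Nat.sub_self, h0]; exact hB x.2)

/-- If every morphism of `F` on `A` extends to `RA`, mapping `R` to itself, then `R` is normal in
`F`. -/
theorem isNormalSubgroup_of_extend [Finite P] {F : FusionSystem P} {R : Subgroup G} (hR : R ≤ P)
    (h : ∀ A f, F.Mor A f →
      ∃ f', F.Mor (R ⊔ A) f' ∧ (∀ x ∈ A, f' x = f x) ∧ ∀ x ∈ R, f' x ∈ R) :
    F.IsNormalSubgroup R := by
  have := finite_of_le hR
  have hN : P ≤ Subgroup.normalizer (R : Set G) := by
    have key : ∀ y ∈ P, ∀ x ∈ R, y⁻¹ * x * y ∈ R := by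
      intro y hy x hx
      obtain ⟨f', hf', hext, hfR⟩ := h P _ (F.mor_conj le_rfl hy)
      rw [← hext x (hR hx)]
      exact hfR x hx
    intro y hy
    refine Subgroup.mem_normalizer_iff''.2 fun x => ⟨key y hy x, fun hx => ?_⟩
    have := key _ (inv_mem hy) _ hx
    simpa [mul_assoc] using this
  refine ⟨hR, (inf_eq_left.2 hN).symm, fun A B => Set.ext fun φ =>
    ⟨fun hφ => ?_, fun hφ => hφ.2.2.1⟩⟩
  obtain ⟨hA, hB⟩ := F.le_of_mem hφ
  obtain ⟨f', hf', hext, hfR⟩ := h A _ (mor_toFun hφ)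
  have him : img R f' = R := (hf'.restrict le_sup_left).img_eq_self hfR
  have hmaps : ∀ x ∈ R ⊔ A, f' x ∈ R ⊔ B := by
    intro x hx
    have hRA : A ≤ Subgroup.normalizer (R : Set G) := hA.trans hN
    rw [← SetLike.mem_coe, Subgroup.coe_mul_of_right_le_normalizer_left _ _ hRA] at hx
    obtain ⟨r, hr, a, ha, rfl⟩ := hx
    change f' (r * a) ∈ _
    rw [hf'.map_mul (Subgroup.mem_sup_left hr) (Subgroup.mem_sup_right ha), hext a ha]
    refine mul_mem (Subgroup.mem_sup_left (hfR r hr)) (Subgroup.mem_sup_right ?_)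
    rw [toFun_mk φ ha]
    exact (φ _).2
  obtain ⟨φ', hφ', e⟩ := hf'.exists_hom (sup_le hR hB) hmaps
  refine ⟨le_inf hA (hA.trans hN), le_inf hB (hB.trans hN), hφ, φ', hφ', ⟨le_sup_right, ?_⟩, ?_⟩
  · intro x
    rw [e, Subgroup.coe_inclusion, hext x x.2, toFun_coe]
  · conv_rhs => rw [← him]
    ext y
    rw [(hf'.restrict le_sup_left).mem_img]
    constructor
    · rintro ⟨x, rfl⟩
      exact ⟨x, x.2, (e (Subgroup.inclusion le_sup_left x)).symm⟩
    · rintro ⟨x, hx, rfl⟩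
      exact ⟨⟨x, hx⟩, e (Subgroup.inclusion le_sup_left ⟨x, hx⟩)⟩

theorem IsNormalSubgroup.exists_extension {F : FusionSystem P} {R : Subgroup G}
    (h : F.IsNormalSubgroup R) {A : Subgroup G} {f : G → G} (hf : F.Mor A f) :
    ∃ f', F.Mor (R ⊔ A) f' ∧ (∀ x ∈ A, f' x = f x) ∧ img R f' = R := by
  obtain ⟨φ, hφ, e⟩ := hf
  rw [h.hom_eq] at hφ
  obtain ⟨-, -, -, φ', hφ', ⟨hle, hext⟩, him⟩ := hφ
  have hm := mor_toFun hφ'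
  refine ⟨toFun φ', hm, fun x hx => ?_, ?_⟩
  · rw [← e ⟨x, hx⟩, ← hext, ← toFun_coe]
    rfl
  · rw [← (hm.restrict le_sup_left).image_eq_img (φ := φ'.comp (Subgroup.inclusion le_sup_left))]
    · exact him
    · exact fun x => (toFun_coe φ' (Subgroup.inclusion le_sup_left x)).symm

/-- Induction on the index of `A`. When the image is fully normalized, its chain stabilizer consists
of conjugations from `P`, so `f` extends over the normalizer of `A` in `M 1`. In general both `ψ ∘
f` and `ψ` have fully normalized image for a suitable `ψ`, and `f` is recovered as a quotient of
their extensions. -/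
theorem exists_extension_sup_of_chain {p : ℕ} [Fact p.Prime] [Finite P] (hP : IsPGroup p P)
    {F : FusionSystem P} (hF : F.IsSaturated p) {M : ℕ → Subgroup G}
    (hM : ∀ i, F.Preserves (M i)) (h0 : M 0 = P) (h1 : M 1 ≤ P)
    (hcomm : ∀ i, ∀ x ∈ M 1, ∀ y ∈ M i, x⁻¹ * y * x * y⁻¹ ∈ M (i + 1)) {n : ℕ} (hn : M n = ⊥)
    {A : Subgroup G} {f : G → G} (hf : F.Mor A f) :
    ∃ f', F.Mor (M 1 ⊔ A) f' ∧ ∀ x ∈ A, f' x = f x := by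
  induction hc : Nat.card P - Nat.card A using Nat.strong_induction_on generalizing A f with
  | _ c ih =>
  subst hc
  by_cases hRA : M 1 ≤ A
  · rw [sup_eq_right.2 hRA]
    exact ⟨f, hf, fun _ _ => rfl⟩
  have hA := hf.le
  have hPN := (hM 1).le_normalizer h1
  have hsup : ∀ {C : Subgroup G}, C ≤ P → ∀ {x}, x ∈ M 1 ⊔ C → ∃ r ∈ M 1, ∃ a ∈ C, r * a = x := by
    intro C hC x hx
    rw [← SetLike.mem_coe, Subgroup.coe_mul_of_right_le_normalizer_left _ _ (hC.trans hPN)] at hx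
    exact hx
  have := finite_of_le h1
  have step : ∀ {A' : Subgroup G} {f' : G → G}, F.Mor A' f' → Nat.card A' = Nat.card A →
      ¬ M 1 ≤ A' → F.FullyNormalized (img A' f') →
      ∃ f'', F.Mor (M 1 ⊔ A') f'' ∧ ∀ x ∈ A', f'' x = f' x := by
    intro A f hf hcard hRA hB
    have hA := hf.le
    have hBP := hB.1
    have := finite_of_le hA
    have := finite_of_le hBP
    obtain ⟨_, hFA⟩ := hF.fullyAutomized hP hB
    let K := (F.chainStabilizer hBP hM).map (F.aut _ hBP).subtype
    -- A normal `p`-subgroup lies in every Sylow `p`-subgroup: its join with `Aut_P(B)` is a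
    -- `p`-group, so maximality applies.
    have hK : K ≤ innAut P (img A f) := by
      have hI : IsPGroup p ((innAut P (img A f)).subgroupOf (F.aut _ hBP)) :=
        (isPGroup_innAut hP _).comap_of_injective _ (Subgroup.subtype_injective _)
      have hT := IsPGroup.to_sup_of_normal_right hI
        (isPGroup_chainStabilizer hP F hBP hM h0 hn)
      have hmap := hFA _ (hT.map (F.aut _ hBP).subtype) ?_ ?_
      · exact (Subgroup.map_mono le_sup_right).trans hmap
      · refine le_trans ?_ (Subgroup.map_mono le_sup_left)
        rw [Subgroup.map_subgroupOf_eq_of_le (F.innAut_le_aut hBP)]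
      · exact Subgroup.map_subtype_le _
    let D := M 1 ⊓ Subgroup.normalizer (A : Set G)
    have hDP : D ≤ P := inf_le_left.trans h1
    obtain ⟨g, hg, hgf, hgf'⟩ := hf.exists_inv
    obtain ⟨f₁, hf₁, hext₁⟩ := hF.exists_extension (D := D) hf hB hDP inf_le_right (by
      intro x hx
      have hxA := Subgroup.mem_normalizer_iff''.1 hx.2
      -- Conjugation by `x`, transported to `B = Af` through `f`, stabilizes the chain by `hcomm`,
      -- as `f` preserves its terms.
      have hm := (hg.comp (F.mor_conj hA (hDP hx)) fun y hy => (hgf' y hy).1).comp hf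
        fun y hy => (hxA _).1 (hgf' y hy).1
      obtain ⟨α, hα, hαe⟩ := hm.exists_aut fun y hy =>
        mem_img_of_mem f ((hxA _).1 (hgf' y hy).1)
      have hαK : (⟨α, hα⟩ : F.aut _ hBP) ∈ F.chainStabilizer hBP hM := by
        intro i u hu
        obtain ⟨a, ha, hau⟩ := hf.mem_img.1 u.2
        have haM : a ∈ M i := ((hM i).mem_iff hf ha).1 (hau ▸ hu)
        have hxa : x⁻¹ * a * x ∈ A := (hxA a).1 ha
        change (α u : G) * (u : G)⁻¹ ∈ _
        rw [hαe, ← hau]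
        change f (x⁻¹ * g (f a) * x) * (f a)⁻¹ ∈ _
        rw [hgf a ha, ← hf.map_inv ha, ← hf.map_mul hxa (inv_mem ha)]
        exact hM _ hf _ (mul_mem hxa (inv_mem ha)) (hcomm i x hx.1 a haM)
      obtain ⟨y, hy, hyα⟩ := hK ⟨_, hαK, rfl⟩
      refine ⟨y, hy, fun a ha => ?_⟩
      have h1 := hαe ⟨f a, mem_img_of_mem f ha⟩
      have h2 : (α ⟨f a, mem_img_of_mem f ha⟩ : G) = _ := hyα ⟨f a, mem_img_of_mem f ha⟩
      rw [h2] at h1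
      change _ = f (x⁻¹ * g (f a) * x) at h1
      rw [hgf a ha] at h1
      exact h1.symm)
    have hRAP : M 1 ⊔ A ≤ P := sup_le h1 hA
    have := finite_of_le hRAP
    obtain ⟨x, hx, hxA, hxN⟩ := exists_mem_normalizer_notMem
      (hP.to_le hRAP) (le_sup_right : A ≤ M 1 ⊔ A) (fun h => hRA (h ▸ le_sup_left))
    obtain ⟨r, hr, a, ha, rfl⟩ := hsup hA hx
    -- The factor `r` of `x = ra` normalizes `A` because `x` and `a` do, so `A ⊔ D` is strictly
    -- larger than `A`.
    have hrD : r ∈ D := ⟨hr, (Subgroup.mul_mem_cancel_right _ (Subgroup.le_normalizer ha)).1 hxN⟩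
    have hrA : r ∉ A := fun h => hxA (mul_mem h ha)
    have hADP : A ⊔ D ≤ P := sup_le hA hDP
    have := finite_of_le hADP
    have hlt : Nat.card A < Nat.card ↥(A ⊔ D) := by
      by_contra! hle
      exact hrA (Subgroup.eq_of_le_of_card_ge le_sup_left hle ▸ Subgroup.mem_sup_right hrD)
    have hle : Nat.card ↥(A ⊔ D) ≤ Nat.card P := Subgroup.card_le_of_le hADP
    obtain ⟨f₂, hf₂, hext₂⟩ := ih _ (by omega) hf₁ rfl
    refine ⟨f₂, hf₂.restrict (sup_le_sup_left le_sup_left _), fun x hx => ?_⟩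
    rw [hext₂ x (Subgroup.mem_sup_left hx), hext₁ x hx]
  obtain ⟨ψ, hψ, hψB⟩ := F.exists_mor_fullyNormalized hf.img_le_self
  have hcomp := hf.comp_img hψ
  obtain ⟨h₁, hh₁, hext₁⟩ := step hcomp rfl hRA (hf.img_img hψ ▸ hψB)
  have hRA' : ¬ M 1 ≤ img A f := by
    intro h
    obtain ⟨g, hg, -, hgf⟩ := hf.exists_inv
    have him := (hg.restrict h).img_eq_self fun x hx => hM 1 hg x (h hx) hx
    exact hRA (him ▸ img_le fun x hx => (hgf x (h hx)).1)
  obtain ⟨h₂, hh₂, hext₂⟩ := step hψ hf.card_img hRA' hψB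
  obtain ⟨g, hg, hgh, -⟩ := hh₂.exists_inv
  have him₂ := (hh₂.restrict le_sup_left).img_eq_self fun x hx =>
    hM 1 hh₂ x (Subgroup.mem_sup_left hx) hx
  -- The quotient of `h₁` by `h₂` makes sense because both map `M 1` into itself, `h₂` onto it, and
  -- they agree along `f` on `A`.
  have hmaps : ∀ x ∈ M 1 ⊔ A, h₁ x ∈ img (M 1 ⊔ img A f) h₂ := by
    intro x hx
    obtain ⟨r, hr, a, ha, rfl⟩ := hsup hA hx
    rw [hh₁.map_mul (Subgroup.mem_sup_left hr) (Subgroup.mem_sup_right ha)]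
    refine mul_mem ?_ ?_
    · have := hM 1 hh₁ r (Subgroup.mem_sup_left hr) hr
      rw [← him₂, (hh₂.restrict le_sup_left).mem_img] at this
      obtain ⟨r', hr', e⟩ := this
      exact e ▸ mem_img_of_mem h₂ (Subgroup.mem_sup_left hr')
    · rw [hext₁ a ha, Function.comp_apply, ← hext₂ _ (mem_img_of_mem f ha)]
      exact mem_img_of_mem h₂ (Subgroup.mem_sup_right (mem_img_of_mem f ha))
  refine ⟨g ∘ h₁, hh₁.comp hg hmaps, fun x hx => ?_⟩
  rw [Function.comp_apply, hext₁ x hx, Function.comp_apply, ← hext₂ _ (mem_img_of_mem f hx),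
    hgh _ (Subgroup.mem_sup_right (mem_img_of_mem f hx))]

/-- In a saturated system a subgroup with a central series of strongly closed subgroups is
normal. -/
theorem isNormalSubgroup_of_central_series {p : ℕ} [Fact p.Prime] [Finite P] (hP : IsPGroup p P)
    {F : FusionSystem P} (hF : F.IsSaturated p) {L : ℕ → Subgroup G}
    (hL : ∀ i, F.Preserves (L i)) (h0 : L 0 ≤ P)
    (hcomm : ∀ i, ∀ x ∈ L 0, ∀ y ∈ L i, x⁻¹ * y * x * y⁻¹ ∈ L (i + 1)) {n : ℕ} (hn : L n = ⊥) :
    F.IsNormalSubgroup (L 0) := by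
  -- Putting `P` on top makes the chain reach all of every `B ≤ P`, as needed for its stabilizer to
  -- be a `p`-group. The new commutator condition is just normality of `L 0` in `P`.
  let M : ℕ → Subgroup G := fun i => Nat.casesOn i P L
  have hM : ∀ i, F.Preserves (M i) := by
    rintro (_ | i)
    · exact fun A f hf x hx _ => hf.map_mem hx
    · exact hL i
  have hM' : ∀ i, ∀ x ∈ M 1, ∀ y ∈ M i, x⁻¹ * y * x * y⁻¹ ∈ M (i + 1) := by
    rintro (_ | i) x hx y hy
    · have := (hL 0).conj_mem h0 hx (inv_mem (show y ∈ P from hy))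
      rw [inv_inv] at this
      change x⁻¹ * y * x * y⁻¹ ∈ L 0
      simpa [mul_assoc] using mul_mem (inv_mem (show x ∈ L 0 from hx)) this
    · exact hcomm i x hx y hy
  refine isNormalSubgroup_of_extend h0 fun A f hf => ?_
  obtain ⟨f', hf', hext⟩ := exists_extension_sup_of_chain (M := M) (n := n + 1) hP hF hM rfl
    h0 hM' hn hf
  exact ⟨f', hf', hext, fun x hx => hL 0 hf' x (Subgroup.mem_sup_left hx) hx⟩

end FusionSystem

/-! ### Normal subsystems -/

namespace FusionSystem

variable {P Q : Subgroup G}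

theorem IsSubsystem.mor {E : FusionSystem Q} {F : FusionSystem P} (h : E.IsSubsystem F)
    {A : Subgroup G} {f : G → G} (hf : E.Mor A f) : F.Mor A f := by
  obtain ⟨φ, hφ, e⟩ := hf
  exact (mor_toFun (h.2 _ _ hφ)).congr fun x hx => (toFun_mk φ hx).trans (e ⟨x, hx⟩)

theorem Preserves.of_isSubsystem {E : FusionSystem Q} {F : FusionSystem P} (h : E.IsSubsystem F)
    {X : Subgroup G} (hX : F.Preserves X) : E.Preserves X :=
  fun _ _ hf => hX (h.mor hf)

/-- The conjugate of a morphism of an invariant subsystem `E` by a morphism of `F`. -/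
theorem IsInvariant.exists_conj {E : FusionSystem Q} {F : FusionSystem P} (h : E.IsInvariant F)
    {R S : Subgroup G} (hRS : R ≤ S) (hSQ : S ≤ Q) {a ψ : G → G} (ha : E.Mor R a)
    (haS : ∀ r ∈ R, a r ∈ S) (hψ : F.Mor S ψ) :
    ∃ χ, E.Mor (img R ψ) χ ∧ ∀ r ∈ R, χ (ψ r) = ψ (a r) := by
  obtain ⟨φ, hφ, e⟩ := ha.exists_hom hSQ haS
  obtain ⟨ψ', hψ', e'⟩ := id hψ
  obtain ⟨χ, hχ, hχe⟩ := h.conj R S hRS hSQ φ hφ ψ' hψ'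
  have him : image (ψ'.comp (Subgroup.inclusion hRS)) = img R ψ :=
    (hψ.restrict hRS).image_eq_img fun x => e' _
  refine ⟨toFun χ, him ▸ mor_toFun hχ, fun r hr => ?_⟩
  have h1 := hχe ⟨r, hr⟩
  have h2 : ((toImage (ψ'.comp (Subgroup.inclusion hRS)) ⟨r, hr⟩ :
      image (ψ'.comp (Subgroup.inclusion hRS))) : G) = ψ r := e' (Subgroup.inclusion hRS ⟨r, hr⟩)
  rw [← h2, toFun_coe, h1, e', e]

theorem IsNormalIn.finite [Finite P] {p : ℕ} {E : FusionSystem Q} {F : FusionSystem P}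
    (h : E.IsNormalIn p F) : Finite Q :=
  finite_of_le h.invariant.subsystem.1

/-- For a normal subsystem `E` on `Q`, a subgroup of `Q` preserved by `E` and by `Aut_F(Q)` is
preserved by `F`. -/
theorem IsNormalIn.preserves {p : ℕ} [Fact p.Prime] [Finite P] (hP : IsPGroup p P)
    {E : FusionSystem Q} {F : FusionSystem P} (hF : F.IsSaturated p) (hE : E.IsNormalIn p F)
    {X : Subgroup G} (hXQ : X ≤ Q) (hX : E.Preserves X)
    (hXA : ∀ α, F.Mor Q α → ∀ x ∈ X, α x ∈ X) : F.Preserves X := by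
  have hinv := hE.invariant
  have hsub := hinv.subsystem
  have hQP := hsub.1
  have hQ := hP.to_le hQP
  have hQF := hinv.stronglyClosed.preserves
  have := hE.finite
  -- The equivalence, rather than one implication, allows cancelling morphisms in a composite.
  have key : ∀ A f, A ≤ Q → F.Mor A f → ∀ x ∈ A, f x ∈ X ↔ x ∈ X := by
    intro A f hAQ hf
    induction hc : Nat.card Q - Nat.card A using Nat.strong_induction_on generalizing A f with
    | _ c ih =>
    subst hc
    by_cases hAeq : A = Q
    · subst hAeq
      have him := hf.img_eq_self fun x hx => hQF hf x hx hx
      obtain ⟨g, hg, hgf, -⟩ := hf.exists_inv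
      rw [him] at hg
      exact fun x hx => ⟨fun h => hgf x hx ▸ hXA g hg _ h, hXA f hf x⟩
    have hfQ : img A f ≤ Q := img_le fun x hx => hQF hf x hx (hAQ hx)
    -- Morphisms with fully normalized image that carry `Aut_Q(C)` into conjugations from `P` extend
    -- over `N_Q(C)`, so the induction hypothesis covers them.
    have hgrow : ∀ {C : Subgroup G} {ψ : G → G}, C ≤ Q → Nat.card C = Nat.card A → F.Mor C ψ →
        F.FullyNormalized (img C ψ) →
        (∀ x ∈ Q, x ∈ Subgroup.normalizer (C : Set G) →
          ∃ y ∈ P, ∀ g ∈ C, ψ (x⁻¹ * g * x) = y⁻¹ * ψ g * y) →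
        ∀ x ∈ C, ψ x ∈ X ↔ x ∈ X := by
      intro C ψ hCQ hcard hψ hFN hext
      let D := Q ⊓ Subgroup.normalizer (C : Set G)
      have hDQ : D ≤ Q := inf_le_left
      obtain ⟨ψ', hψ', hψψ'⟩ := hF.exists_extension (D := D) hψ hFN (hDQ.trans hQP) inf_le_right
        fun x hx => hext x hx.1 hx.2
      have hCne : C ≠ Q := by
        rintro rfl
        exact hAeq (Subgroup.eq_of_le_of_card_ge hAQ hcard.le)
      obtain ⟨x, hxQ, hxC, hxN⟩ := exists_mem_normalizer_notMem hQ hCQ hCne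
      have hCD : C ⊔ D ≤ Q := sup_le hCQ hDQ
      have := finite_of_le hCD
      have hlt : Nat.card C < Nat.card ↥(C ⊔ D) := by
        by_contra! hle
        exact hxC (Subgroup.eq_of_le_of_card_ge le_sup_left hle ▸
          Subgroup.mem_sup_right (show x ∈ D from ⟨hxQ, hxN⟩))
      have hle : Nat.card ↥(C ⊔ D) ≤ Nat.card Q := Subgroup.card_le_of_le hCD
      intro x hx
      rw [← hψψ' x hx]
      exact ih _ (by omega) _ _ hCD hψ' rfl x (Subgroup.mem_sup_left hx)
    obtain ⟨e₁, he₁, -⟩ := E.exists_mor_fullyNormalized hAQ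
    obtain ⟨e₂, he₂, hB₁⟩ := E.exists_mor_fullyNormalized hfQ
    obtain ⟨g₁, hg₁, hge₁, hge₁'⟩ := he₁.exists_inv
    have hφ₀ : F.Mor (img A e₁) (e₂ ∘ f ∘ g₁) :=
      ((hsub.mor hg₁).comp hf fun y hy => (hge₁' y hy).1).comp (hsub.mor he₂)
        fun y hy => mem_img_of_mem f (hge₁' y hy).1
    have hA₁Q : img A e₁ ≤ Q := he₁.img_le_self
    have hB₁Q : img (img A f) e₂ ≤ Q := he₂.img_le_self
    have him : img (img A e₁) (e₂ ∘ f ∘ g₁) = img (img A f) e₂ := by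
      ext y
      rw [hφ₀.mem_img, he₂.mem_img]
      constructor
      · rintro ⟨x, hx, rfl⟩
        exact ⟨_, mem_img_of_mem f (hge₁' x hx).1, rfl⟩
      · rintro ⟨x, hx, rfl⟩
        obtain ⟨a, ha, rfl⟩ := hf.mem_img.1 hx
        exact ⟨e₁ a, mem_img_of_mem e₁ ha, by simp [hge₁ a ha]⟩
    obtain ⟨ε, hε, hεφ⟩ := hφ₀.exists_mulEquiv
    have hB₁ : E.FullyNormalized (img (img A e₁) (e₂ ∘ f ∘ g₁)) := him ▸ hB₁
    rw [← him] at hB₁Q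
    have := finite_of_le hB₁Q
    -- The Frattini step: invariance sends `Aut_Q(A₁)` into `Aut_E(B₁)`, where `A₁` and `B₁` are the
    -- domain and image of `e₂ ∘ f ∘ g₁`. Sylow's theorem in `Aut_E(B₁)` then moves it into
    -- `Aut_Q(B₁)`, at the cost of an `E`-automorphism `γ`.
    obtain ⟨γ, hγ, hγW⟩ := (hE.saturated.fullyAutomized hQ hB₁).exists_aut hQ hB₁Q ε
      (isPGroup_innAut hQ (img A e₁)) (by
        intro α hα
        have hα' := mor_aut hA₁Q (E.innAut_le_aut hA₁Q hα)
        obtain ⟨χ, hχ, hχe⟩ := hinv.exists_conj le_rfl hA₁Q hα'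
          (fun r hr => toFun_aut α ⟨r, hr⟩ ▸ (α _).2) hφ₀
        refine hχ.mem_aut fun u => ?_
        obtain ⟨a, rfl⟩ := ε.surjective u
        rw [hεφ, hχe a a.2, toFun_aut, ← hεφ]
        simp [MulAut.congr])
    have hγm := mor_aut hB₁Q hγ
    have hφ := hφ₀.comp_img (hsub.mor hγm)
    have hφγ : ∀ a : img A e₁, (toFun γ.toMonoidHom ∘ e₂ ∘ f ∘ g₁) a = γ (ε a) := fun a => by
      rw [Function.comp_apply, ← hεφ, toFun_aut]
    have himφ : img (img A e₁) (toFun γ.toMonoidHom ∘ e₂ ∘ f ∘ g₁) =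
        img (img A e₁) (e₂ ∘ f ∘ g₁) := by
      rw [← hφ₀.img_img (hsub.mor hγm)]
      exact hγm.img_eq_self fun x hx => toFun_aut γ ⟨x, hx⟩ ▸ (γ _).2
    -- `B₁` is fully normalized in `E` but perhaps not in `F`, so the extension axiom of `F` is
    -- applied after a further map `δ ∘ ψ`, chosen to carry `Aut_P(B₁)` into conjugations from `P`.
    obtain ⟨ψ, hψ, hC⟩ := F.exists_mor_fullyNormalized (hB₁Q.trans hQP)
    obtain ⟨η, hη, hηψ⟩ := hψ.exists_mulEquiv
    have := finite_of_le hC.1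
    obtain ⟨δ, hδ, hδW⟩ := (hF.fullyAutomized hP hC).exists_aut hP hC.1 η
      (isPGroup_innAut hP _) (by
        intro α hα
        exact F.comp_mem (F.comp_mem (F.symm_mem hη) (F.innAut_le_aut (hB₁Q.trans hQP) hα)) hη)
    have hδm := mor_aut hC.1 hδ
    have hψ' := hψ.comp_img hδm
    have hψδ : ∀ b : img (img A e₁) (e₂ ∘ f ∘ g₁),
        (toFun δ.toMonoidHom ∘ ψ) b = δ (η b) := fun b => by
      rw [Function.comp_apply, ← hηψ, toFun_aut]
    have himψ : img (img (img A e₁) (e₂ ∘ f ∘ g₁)) (toFun δ.toMonoidHom ∘ ψ) =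
        img (img (img A e₁) (e₂ ∘ f ∘ g₁)) ψ := by
      rw [← hψ.img_img hδm]
      exact hδm.img_eq_self fun x hx => toFun_aut δ ⟨x, hx⟩ ▸ (δ _).2
    have hψext : ∀ x ∈ P, x ∈ Subgroup.normalizer (img (img A e₁) (e₂ ∘ f ∘ g₁) : Set G) →
        ∃ y ∈ P, ∀ g ∈ img (img A e₁) (e₂ ∘ f ∘ g₁),
          (toFun δ.toMonoidHom ∘ ψ) (x⁻¹ * g * x) =
            y⁻¹ * (toFun δ.toMonoidHom ∘ ψ) g * y := by
      intro x hx hxN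
      obtain ⟨α, hα, hαx⟩ := exists_mem_innAut hx hxN
      obtain ⟨y, hy, hyα⟩ := hδW α hα
      refine ⟨y, hy, fun g hg => ?_⟩
      rw [← hαx ⟨g, hg⟩, hψδ, hyα, ← hψδ]
    have hcardA₁ : Nat.card (img A e₁) = Nat.card A := he₁.card_img
    have good₁ := hgrow hB₁Q (hφ₀.card_img.trans hcardA₁) hψ' (himψ.symm ▸ hC)
      fun x hx hxN => hψext x (hQP hx) hxN
    have hψ'' : F.Mor (img (img A e₁) (toFun γ.toMonoidHom ∘ e₂ ∘ f ∘ g₁))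
        (toFun δ.toMonoidHom ∘ ψ) := himφ.symm ▸ hψ'
    have good₂ := hgrow hA₁Q hcardA₁ (hφ.comp_img hψ'')
      (by rw [← hφ.img_img hψ'', himφ, himψ]; exact hC) (by
        intro x hx hxN
        obtain ⟨α, hα, hαx⟩ := exists_mem_innAut hx hxN
        obtain ⟨y, hy, hyα⟩ := hγW α hα
        have hyN : y ∈ Subgroup.normalizer (img (img A e₁) (e₂ ∘ f ∘ g₁) : Set G) := by
          rw [← himφ]
          refine mem_normalizer_of_map hφ hxN fun g hg => ?_
          rw [← hαx ⟨g, hg⟩, hφγ, hyα, ← hφγ]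
        obtain ⟨z, hz, hzy⟩ := hψext y (hQP hy) hyN
        refine ⟨z, hz, fun g hg => ?_⟩
        rw [Function.comp_apply, Function.comp_apply (x := g), ← hαx ⟨g, hg⟩, hφγ, hyα, ← hφγ,
          hzy _ (himφ.le (mem_img_of_mem _ hg))])
    -- `hgrow` handles both `δ ∘ ψ` and its composite with `γ ∘ e₂ ∘ f ∘ g₁`. Cancelling the former,
    -- and then the `E`-morphisms `γ`, `e₂`, `e₁`, leaves `f`.
    intro x hx
    have hx₁ := mem_img_of_mem e₁ hx
    have h1 := good₂ _ hx₁
    have h2 := good₁ _ (himφ.le (mem_img_of_mem _ hx₁))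
    have h3 := hX.mem_iff he₁ hx
    have h4 := hX.mem_iff hγm (mem_img_of_mem (e₂ ∘ f ∘ g₁) hx₁)
    have h5 := hX.mem_iff he₂ (mem_img_of_mem f hx)
    have h6 : (e₂ ∘ f ∘ g₁) (e₁ x) = e₂ (f x) := by simp [hge₁ x hx]
    rw [Function.comp_apply, h2, Function.comp_apply, h4, h6, h5, h3] at h1
    exact h1
  intro A f hf x hx hxX
  exact (key (A ⊓ Q) f inf_le_right (hf.restrict inf_le_left) x ⟨hx, hXQ hxX⟩).2 hxX

theorem Mor.map_lowerCentralSeries {F : FusionSystem P} {A R : Subgroup G} {f : G → G}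
    (hf : F.Mor A f) (hR : R ≤ A) (hfR : ∀ x ∈ R, f x ∈ R) (n : ℕ) :
    ∀ x ∈ R.lowerCentralSeries n, f x ∈ R.lowerCentralSeries n := by
  let ψ : R →* R :=
    { toFun := fun x => ⟨f x, hfR x x.2⟩
      map_one' := Subtype.ext hf.map_one
      map_mul' := fun x y => Subtype.ext (hf.map_mul (hR x.2) (hR y.2)) }
  intro x hx
  rw [← Subgroup.top_subtype_lowerCentralSeries] at hx ⊢
  obtain ⟨y, hy, rfl⟩ := hx
  have hy' := Subgroup.mem_map_of_mem ψ hy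
  rw [Subgroup.map_lowerCentralSeries] at hy'
  exact ⟨ψ y, Subgroup.lowerCentralSeries_mono n le_top hy', rfl⟩

theorem IsNormalSubgroup.preserves_lowerCentralSeries {F : FusionSystem P} {R : Subgroup G}
    (h : F.IsNormalSubgroup R) (n : ℕ) : F.Preserves (R.lowerCentralSeries n) := by
  intro A f hf x hx hxR
  obtain ⟨f', hf', hext, him⟩ := h.exists_extension hf
  rw [← hext x hx]
  exact hf'.map_lowerCentralSeries le_sup_left (fun y hy => him.le (mem_img_of_mem f' hy)) n x hxR

theorem _root_.Fusion.lowerCentralSeries_conj_mem {R : Subgroup G} (i : ℕ) {x y : G} (hx : x ∈ R)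
    (hy : y ∈ R.lowerCentralSeries i) : x⁻¹ * y * x * y⁻¹ ∈ R.lowerCentralSeries (i + 1) := by
  have h := Subgroup.commutator_mem_commutator hy (inv_mem hx)
  have h' := inv_mem h
  rw [commutatorElement_inv, commutatorElement_def, inv_inv] at h'
  exact h'

theorem _root_.IsPGroup.exists_lowerCentralSeries_eq_bot {p : ℕ} [Fact p.Prime] {R : Subgroup G}
    [Finite R] (hR : IsPGroup p R) : ∃ n, R.lowerCentralSeries n = ⊥ :=
  (Subgroup.isNilpotent_iff_lowerCentralSeries R).1 hR.isNilpotent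

/-- `Aut_F(Q)` permutes the subgroups that are normal in an invariant subsystem on `Q`. -/
theorem IsInvariant.isNormalSubgroup_img {E : FusionSystem Q} {F : FusionSystem P} [Finite Q]
    (h : E.IsInvariant F) {R : Subgroup G} (hR : E.IsNormalSubgroup R) {α : G → G}
    (hα : F.Mor Q α) : E.IsNormalSubgroup (img R α) := by
  have hαQ : ∀ x ∈ Q, α x ∈ Q := fun x hx => h.stronglyClosed.preserves hα x hx hx
  have him : img Q α = Q := hα.img_eq_self hαQ
  obtain ⟨β, hβ, hβα, hαβ⟩ := hα.exists_inv
  rw [him] at hβ hαβ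
  have hβQ : ∀ x ∈ Q, β x ∈ Q := fun x hx => (hαβ x hx).1
  refine isNormalSubgroup_of_extend (img_le fun x hx => hαQ x (hR.le hx)) fun A f hf => ?_
  have hA := hf.le
  -- Conjugate `f` by `β = α⁻¹`, extend over `R` by its normality, and conjugate back by `α`;
  -- invariance keeps both conjugates in `E`.
  obtain ⟨χ, hχ, hχe⟩ := h.exists_conj hA le_rfl hf (fun _ hx => hf.map_mem hx) hβ
  obtain ⟨χ', hχ', hext, himR⟩ := hR.exists_extension hχ
  obtain ⟨f', hf', hfe⟩ := h.exists_conj hχ'.le le_rfl hχ' (fun _ hx => hχ'.map_mem hx) hα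
  refine ⟨f', hf'.restrict (sup_le ?_ fun a ha => ?_), fun a ha => ?_, fun x hx => ?_⟩
  · exact img_le fun x hx => mem_img_of_mem α (Subgroup.mem_sup_left hx)
  · rw [← (hαβ a (hA ha)).2]
    exact mem_img_of_mem α (Subgroup.mem_sup_right (mem_img_of_mem β ha))
  · have hβa := mem_img_of_mem β ha
    have := hfe _ (Subgroup.mem_sup_right hβa)
    rwa [(hαβ a (hA ha)).2, hext _ hβa, hχe a ha, (hαβ _ (hf.map_mem ha)).2] at this
  · obtain ⟨r, hr, rfl⟩ := (hα.restrict hR.le).mem_img.1 hx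
    rw [hfe r (Subgroup.mem_sup_left hr)]
    exact mem_img_of_mem α (himR.le (mem_img_of_mem χ' hr))

/-- Any `α ∈ Aut_F(Q)` maps `E.Op` to an `E`-normal subgroup, hence into `E.Op`, and so preserves
its lower central series. -/
theorem IsNormalIn.isNormalSubgroup_Op {p : ℕ} [Fact p.Prime] [Finite P] (hP : IsPGroup p P)
    {E : FusionSystem Q} {F : FusionSystem P} (hF : F.IsSaturated p) (hE : E.IsNormalIn p F) :
    F.IsNormalSubgroup E.Op := by
  have := hE.finite
  have hQP := hE.invariant.subsystem.1
  have hR : E.IsNormalSubgroup E.Op := E.isGreatest_Op.1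
  have hRP := hR.le.trans hQP
  have := finite_of_le hRP
  obtain ⟨n, hn⟩ := (hP.to_le hRP).exists_lowerCentralSeries_eq_bot
  refine isNormalSubgroup_of_central_series (L := E.Op.lowerCentralSeries) (n := n) hP hF (fun i => ?_)
    hRP (fun i x hx y hy => lowerCentralSeries_conj_mem i hx hy) hn
  refine hE.preserves hP hF ((Subgroup.lowerCentralSeries_le_self _ i).trans hR.le)
    (hR.preserves_lowerCentralSeries i) fun α hα => ?_
  exact hα.map_lowerCentralSeries hR.le
    (fun x hx => E.isGreatest_Op.2 (hE.invariant.isNormalSubgroup_img hR hα)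
      (mem_img_of_mem α hx)) i

theorem IsNormalIn.isNormalSubgroup_Op_inf {p : ℕ} [Fact p.Prime] [Finite P] (hP : IsPGroup p P)
    {E : FusionSystem Q} {F : FusionSystem P} (hE : E.IsNormalIn p F) :
    E.IsNormalSubgroup (F.Op ⊓ Q) := by
  have := hE.finite
  have hsub := hE.invariant.subsystem
  have hS : F.IsNormalSubgroup F.Op := F.isGreatest_Op.1
  have := finite_of_le hS.le
  have hQ := hE.invariant.stronglyClosed.preserves
  obtain ⟨n, hn⟩ := (hP.to_le hS.le).exists_lowerCentralSeries_eq_bot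
  refine isNormalSubgroup_of_central_series (L := fun i => F.Op.lowerCentralSeries i ⊓ Q) (n := n)
    (hP.to_le hsub.1) hE.saturated
    (fun i => ((hS.preserves_lowerCentralSeries i).inf hQ).of_isSubsystem hsub)
    inf_le_right (fun i x hx y hy => ⟨lowerCentralSeries_conj_mem i hx.1 hy.1, ?_⟩) ?_
  · exact Q.mul_mem (Q.mul_mem (Q.mul_mem (Q.inv_mem hx.2) hy.2) hx.2) (Q.inv_mem hy.2)
  · rw [hn, bot_inf_eq]

end FusionSystem

end Fusion

theorem mainTheorem10 {G : Type*} [Group G] (p : ℕ) [Fact p.Prime] (P : Subgroup G) [Finite P]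
    (hP : IsPGroup p P) (F : Fusion.FusionSystem P) (hF : F.IsSaturated p)
    (Q : Subgroup G) (E : Fusion.FusionSystem Q) (hE : E.IsNormalIn p F) :
    F.Op ⊓ Q = E.Op ∧ (E.Op ≠ ⊥ → F.Op ≠ ⊥) := by
  have := hE.finite
  have heq : F.Op ⊓ Q = E.Op := by
    refine le_antisymm (E.isGreatest_Op.2 (hE.isNormalSubgroup_Op_inf hP)) (le_inf ?_ ?_)
    · exact F.isGreatest_Op.2 (hE.isNormalSubgroup_Op hP hF)
    · exact E.isGreatest_Op.1.le
  refine ⟨heq, fun hne h => hne ?_⟩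
  rw [← heq, h, bot_inf_eq]
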